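/- Let $X\subset\mathbb C$ be a nonempty perfect compact set that is uniformly regular: any two points of $X$ are joined by a rectifiable path in $X$, and there is a constant $C$ such that the geodesic distance (the infimum of the lengths of paths in $X$) satisfies $\delta(z,w)\le C|z-w|$ for all $z,w\in X$. Let $(M_n)_{n\ge0}$ be positive numbers with $M_0=1$, $\dfrac{M_{n+m}}{M_nM_m}\ge\dbinom{n+m}{m}$ for all $n,m\ge 0$, and $\lim_{n\to\infty}(n!/M_n)^{1/n}=0$ (a nonanalytic weight). Let $D(X,M)$ be the algebra of infinitely differentiable functions $f:X\to\mathbb C$ (derivatives are limits of difference quotients within $X$) with $$\|f\|_D=\sum_{n=0}^\infty \frac{\|f^{(n)}\|_\infty}{M_n}<\infty ,$$ with pointwise operations and the norm $\|\cdot\|_D$. A bounded linear operator $T$ on a complex normed space is called a Riesz operator if for every $\lambda\ne0$: $\lambda-T$ is open as a map onto its range; its range is closed; its kernel and its cokernel have the same finite dimension; and the chains $N((\lambda-T)^k)$ and $R((\lambda-T)^k)$, $k\ge 0$, have finite and equal lengths; and if moreover every nonzero element of the spectrum is an eigenvalue and for every $\varepsilon>0$ only finitely many elements of the spectrum have modulus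 at least $\varepsilon$. **Theorem.** Let $T$ be a Riesz endomorphism of the algebra $D(X,M)$ induced by a selfmap $\varphi$ of $X$, that is, $Tf=f\circ\varphi$ for all $f\in D(X,M)$. Then $\varphi$ has exactly one fixed point $x_0\in X$, $\varphi$ is differentiable at $x_0$, and $$\sigma(T)=\{\varphi'(x_0)^n : n\ge 1\}\cup\{0,1\}.$$ Moreover, each nonzero element of $\sigma(T)$ is an eigenvalue of multiplicity $1$, both geometrically and algebraically (the eigenspace and the generalized eigenspace are one-dimensional). -/

import Mathlib

open Filter Topology

noncomputable section

/-! ## Riesz operators -/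

/-- A bounded operator `T` on a complex normed space is a Riesz operator if, for every `z ≠ 0`:
`z - T` is open as a map onto its range; the range of `z - T` is closed; the kernel and the
cokernel of `z - T` have the same finite dimension; the chain of kernels and the chain of ranges of
the powers of `z - T` both become stationary, at the same (first) index; and, moreover, every
nonzero spectral value is an eigenvalue, and the spectrum has no accumulation point other than
`0`. -/
structure IsRieszOperator {E : Type*} [NormedAddCommGroup E] [NormedSpace ℂ E]
    (T : E →L[ℂ] E) : Prop where
  open_onto_range : ∀ z : ℂ, z ≠ 0 →
    IsOpenMap (Set.rangeFactorization (fun f : E => z • f - T f))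
  closed_range : ∀ z : ℂ, z ≠ 0 → IsClosed (Set.range (fun f : E => z • f - T f))
  finite_ker : ∀ z : ℂ, z ≠ 0 →
    FiniteDimensional ℂ (LinearMap.ker (z • LinearMap.id - (T : E →ₗ[ℂ] E)))
  finite_coker : ∀ z : ℂ, z ≠ 0 →
    FiniteDimensional ℂ (E ⧸ LinearMap.range (z • LinearMap.id - (T : E →ₗ[ℂ] E)))
  ker_eq_coker : ∀ z : ℂ, z ≠ 0 →
    Module.finrank ℂ (LinearMap.ker (z • LinearMap.id - (T : E →ₗ[ℂ] E))) =
      Module.finrank ℂ (E ⧸ LinearMap.range (z • LinearMap.id - (T : E →ₗ[ℂ] E)))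
  chain_length : ∀ z : ℂ, z ≠ 0 → ∃ p : ℕ,
    IsLeast {k : ℕ | LinearMap.ker ((z • LinearMap.id - (T : E →ₗ[ℂ] E)) ^ k) =
      LinearMap.ker ((z • LinearMap.id - (T : E →ₗ[ℂ] E)) ^ (k + 1))} p ∧
    IsLeast {k : ℕ | LinearMap.range ((z • LinearMap.id - (T : E →ₗ[ℂ] E)) ^ k) =
      LinearMap.range ((z • LinearMap.id - (T : E →ₗ[ℂ] E)) ^ (k + 1))} p
  eigenvalue : ∀ z ∈ spectrum ℂ T, z ≠ 0 → ∃ f : E, f ≠ 0 ∧ T f = z • f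
  discrete : ∀ ε : ℝ, 0 < ε → {z ∈ spectrum ℂ T | ε ≤ ‖z‖}.Finite

/-! ## Uniformly regular plane sets -/

/-- The length of a path in the plane set `X`: the total variation of the path in the plane. -/
def pathLength {X : Set ℂ} {z w : X} (γ : Path z w) : ENNReal :=
  eVariationOn (fun t : unitInterval => ((γ t : X) : ℂ)) Set.univ

/-- The geodesic distance in `X`: the infimum of the lengths of the paths in `X` between two
points. -/
def geodesicDist (X : Set ℂ) (z w : X) : ENNReal := ⨅ γ : Path z w, pathLength γ

/-- `X` is uniformly regular: any two points of `X` are joined by a rectifiable path in `X`, and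
the geodesic distance is at most a constant multiple of the Euclidean distance (the Euclidean
distance never exceeds the geodesic distance, so the two metrics are equivalent with uniform
constants). -/
def UniformlyRegular (X : Set ℂ) : Prop :=
  (∀ z w : X, ∃ γ : Path z w, pathLength γ ≠ ⊤) ∧
  ∃ C : NNReal, ∀ z w : X, geodesicDist X z w ≤ C * edist (z : ℂ) (w : ℂ)

/-! ## Differentiable functions on plane sets -/

namespace PlaneSet

variable {X : Set ℂ}

/-- Extension by zero of a function on `X`; only its values on `X` are ever used. -/
def zeroExt (f : X → ℂ) : ℂ → ℂ := Function.extend Subtype.val f 0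

/-- `f` is complex differentiable at the point `x` of `X` as a function on `X`: the difference
quotients `(f w - f x) / (w - x)` have a limit as `w → x` with `w ∈ X`, `w ≠ x`. -/
def DiffAt (f : X → ℂ) (x : X) : Prop := DifferentiableWithinAt ℂ (zeroExt f) X x

/-- The derivative `f'` of a function on `X`. -/
def der (f : X → ℂ) : X → ℂ := fun x => derivWithin (zeroExt f) X x

/-- Infinitely differentiable functions on `X`; `der^[n] f` is the `n`-th derivative `f⁽ⁿ⁾`. -/
def Smooth (f : X → ℂ) : Prop := ∀ n : ℕ, ∀ x : X, DiffAt (der^[n] f) x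

/-- The supremum norm on `X`. -/
def supNorm (f : X → ℂ) : ℝ := ⨆ x : X, ‖f x‖

@[simp] lemma zeroExt_coe (f : X → ℂ) (x : X) : zeroExt f x = f x :=
  Subtype.val_injective.extend_apply f 0 x

lemma zeroExt_eqOn {f : X → ℂ} {g : ℂ → ℂ} (h : ∀ x : X, f x = g x) : Set.EqOn (zeroExt f) g X := by
  intro x hx
  exact (zeroExt_coe f ⟨x, hx⟩).trans (h ⟨x, hx⟩)

/-- Differentiability on `X` and the derivative through difference quotients within `X`. -/
lemma hasDerivWithinAt_zeroExt_iff (f : X → ℂ) (x : X) (d : ℂ) :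
    HasDerivWithinAt (zeroExt f) d X x ↔
      Tendsto (fun w : X => (f w - f x) / ((w : ℂ) - x)) (𝓝[≠] x) (𝓝 d) := by
  have h : (fun w : X => (f w - f x) / ((w : ℂ) - x)) =
      slope (zeroExt f) (x : ℂ) ∘ (Subtype.val : X → ℂ) := by
    funext w
    simp [slope_def_field]
  have hm : map (Subtype.val : X → ℂ) (𝓝[≠] x) = 𝓝[X \ {(x : ℂ)}] (x : ℂ) := by
    rw [Topology.IsEmbedding.subtypeVal.map_nhdsWithin_eq]
    congr 1
    ext y
    simp only [Set.mem_image, Set.mem_compl_iff, Set.mem_singleton_iff, Set.mem_sdiff]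
    constructor
    · rintro ⟨w, hw, rfl⟩
      exact ⟨w.2, fun e => hw (Subtype.ext e)⟩
    · rintro ⟨hy, hne⟩
      exact ⟨⟨y, hy⟩, fun e => hne (congrArg Subtype.val e), rfl⟩
  rw [hasDerivWithinAt_iff_tendsto_slope, h, ← tendsto_map'_iff, hm]

lemma diffAt_congr {f : X → ℂ} {g : ℂ → ℂ} (h : ∀ x : X, f x = g x) (x : X)
    (hg : DifferentiableWithinAt ℂ g X x) : DiffAt f x :=
  hg.congr (zeroExt_eqOn h) (zeroExt_eqOn h x.2)

lemma der_congr {f : X → ℂ} {g : ℂ → ℂ} (h : ∀ x : X, f x = g x) (x : X) :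
    der f x = derivWithin g X x :=
  derivWithin_congr (zeroExt_eqOn h) (zeroExt_eqOn h x.2)

lemma diffAt_const (c : ℂ) (x : X) : DiffAt (fun _ : X => c) x :=
  diffAt_congr (g := fun _ => c) (fun _ => rfl) x (differentiableWithinAt_const c)

lemma der_const (c : ℂ) : der (fun _ : X => c) = fun _ => 0 := by
  funext x
  rw [der_congr (g := fun _ => c) (fun _ => rfl) x]
  simp

lemma diffAt_add {f g : X → ℂ} {x : X} (hf : DiffAt f x) (hg : DiffAt g x) :
    DiffAt (f + g) x :=
  diffAt_congr (g := zeroExt f + zeroExt g) (fun _ => by simp) x (DifferentiableWithinAt.add hf hg)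

lemma der_add {f g : X → ℂ} (hf : ∀ x, DiffAt f x) (hg : ∀ x, DiffAt g x) :
    der (f + g) = der f + der g := by
  funext x
  rw [der_congr (g := zeroExt f + zeroExt g) (fun _ => by simp) x, derivWithin_add (hf x) (hg x)]
  rfl

lemma diffAt_mul {f g : X → ℂ} {x : X} (hf : DiffAt f x) (hg : DiffAt g x) :
    DiffAt (f * g) x :=
  diffAt_congr (g := zeroExt f * zeroExt g) (fun _ => by simp) x (DifferentiableWithinAt.mul hf hg)

lemma der_mul {f g : X → ℂ} (hf : ∀ x, DiffAt f x) (hg : ∀ x, DiffAt g x) :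
    der (f * g) = der f * g + f * der g := by
  funext x
  rw [der_congr (g := zeroExt f * zeroExt g) (fun _ => by simp) x, derivWithin_mul (hf x) (hg x)]
  simp [der]

lemma Smooth.der {f : X → ℂ} (hf : Smooth f) : Smooth (der f) := fun n x => hf (n + 1) x

lemma Smooth.const (c : ℂ) : Smooth (fun _ : X => c) := by
  have key : ∀ n : ℕ, ∀ c : ℂ, ∀ x : X, DiffAt (PlaneSet.der^[n] (fun _ : X => c)) x := by
    intro n
    induction n with
    | zero => exact fun c x => diffAt_const c x
    | succ n ih => intro c x; rw [Function.iterate_succ_apply, der_const]; exact ih 0 x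
  exact fun n x => key n c x

lemma iterate_der_const (c : ℂ) (n : ℕ) (hn : n ≠ 0) :
    PlaneSet.der^[n] (fun _ : X => c) = fun _ => 0 := by
  obtain ⟨m, rfl⟩ := Nat.exists_eq_succ_of_ne_zero hn
  rw [Function.iterate_succ_apply, der_const]
  induction m with
  | zero => rfl
  | succ m ih => rw [Function.iterate_succ_apply, der_const]; exact ih (by simp)

lemma iterate_der_add {f g : X → ℂ} (hf : Smooth f) (hg : Smooth g) (n : ℕ) :
    PlaneSet.der^[n] (f + g) = PlaneSet.der^[n] f + PlaneSet.der^[n] g := by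
  induction n with
  | zero => rfl
  | succ n ih =>
    rw [Function.iterate_succ_apply', ih, der_add (hf n) (hg n), Function.iterate_succ_apply',
      Function.iterate_succ_apply']

lemma Smooth.add {f g : X → ℂ} (hf : Smooth f) (hg : Smooth g) : Smooth (f + g) := by
  intro n x
  rw [iterate_der_add hf hg]
  exact diffAt_add (hf n x) (hg n x)

lemma Smooth.mul {f g : X → ℂ} (hf : Smooth f) (hg : Smooth g) : Smooth (f * g) := by
  have key : ∀ n : ℕ, ∀ f g : X → ℂ, Smooth f → Smooth g → ∀ k ≤ n, ∀ x,
      DiffAt (PlaneSet.der^[k] (f * g)) x := by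
    intro n
    induction n with
    | zero =>
      intro f g hf hg k hk x
      obtain rfl : k = 0 := by omega
      exact diffAt_mul (hf 0 x) (hg 0 x)
    | succ n ih =>
      intro f g hf hg k hk x
      rcases k with _ | k
      · exact diffAt_mul (hf 0 x) (hg 0 x)
      · have hadd : ∀ j ≤ k, PlaneSet.der^[j] (PlaneSet.der f * g + f * PlaneSet.der g) =
            PlaneSet.der^[j] (PlaneSet.der f * g) + PlaneSet.der^[j] (f * PlaneSet.der g) := by
          intro j
          induction j with
          | zero => intro _; rfl
          | succ j ihj =>
            intro hj
            rw [Function.iterate_succ_apply', ihj (by omega),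
              der_add (ih _ _ hf.der hg j (by omega)) (ih _ _ hf hg.der j (by omega)),
              Function.iterate_succ_apply', Function.iterate_succ_apply']
        rw [Function.iterate_succ_apply, der_mul (f := f) (g := g) (hf 0) (hg 0), hadd k le_rfl]
        exact diffAt_add (ih _ _ hf.der hg k (by omega) x) (ih _ _ hf hg.der k (by omega) x)
  exact fun n x => key n f g hf hg n le_rfl x

/-- The Leibniz rule. -/
lemma iterate_der_mul {f g : X → ℂ} (hf : Smooth f) (hg : Smooth g) (n : ℕ) :
    PlaneSet.der^[n] (f * g) = ∑ p ∈ Finset.HasAntidiagonal.antidiagonal n,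
      (n.choose p.1 : ℂ) • (PlaneSet.der^[p.1] f * PlaneSet.der^[p.2] g) := by
  induction n generalizing f g with
  | zero => simp
  | succ n ih =>
    rw [Function.iterate_succ_apply, der_mul (f := f) (g := g) (hf 0) (hg 0),
      iterate_der_add (hf.der.mul hg) (hf.mul hg.der), ih hf.der hg, ih hf hg.der]
    have h := Finset.sum_antidiagonal_choose_succ_nsmul
      (fun i j => PlaneSet.der^[i] f * PlaneSet.der^[j] g) n
    simp only [← Nat.cast_smul_eq_nsmul ℂ] at h
    rw [h, add_comm]
    congr 1
    refine Finset.sum_congr rfl fun p hp => ?_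
    rw [Nat.choose_symm_of_eq_add (Finset.HasAntidiagonal.mem_antidiagonal.1 hp).symm]
    rfl

lemma DiffAt.continuous {f : X → ℂ} (hf : ∀ x, DiffAt f x) : Continuous f := by
  have h : ContinuousOn (zeroExt f) X := fun x hx => (hf ⟨x, hx⟩).continuousWithinAt
  have h2 := continuousOn_iff_continuous_domRestrict.1 h
  have h3 : X.domRestrict (zeroExt f) = f := funext fun x => zeroExt_coe f x
  rwa [h3] at h2

lemma supNorm_nonneg (f : X → ℂ) : 0 ≤ supNorm f := Real.iSup_nonneg fun _ => norm_nonneg _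

lemma le_supNorm [CompactSpace X] {f : X → ℂ} (hf : Continuous f) (x : X) :
    ‖f x‖ ≤ supNorm f :=
  le_ciSup (isCompact_range hf.norm).bddAbove x

lemma supNorm_le {f : X → ℂ} {c : ℝ} (hc : 0 ≤ c) (h : ∀ x, ‖f x‖ ≤ c) : supNorm f ≤ c :=
  Real.iSup_le h hc

end PlaneSet

/-! ## Dales–Davie algebras -/

/-- Weight sequences: positive numbers `M₀ = 1, M₁, M₂, …` with
`Mₙ₊ₘ / (Mₙ Mₘ) ≥ binom (n + m) m`. -/
structure WeightSequence where
  /-- the sequence -/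
  seq : ℕ → ℝ
  pos : ∀ n, 0 < seq n
  zero : seq 0 = 1
  choose_le : ∀ n m : ℕ, ((n + m).choose m : ℝ) ≤ seq (n + m) / (seq n * seq m)

/-- The weight sequence is nonanalytic: `(n! / Mₙ)^(1/n) → 0`. -/
def WeightSequence.Nonanalytic (M : WeightSequence) : Prop :=
  Tendsto (fun n : ℕ => ((n.factorial : ℝ) / M.seq n) ^ ((1 : ℝ) / n)) atTop (𝓝 0)

namespace DalesDavie

open PlaneSet

variable {X : Set ℂ} {M : WeightSequence}

/-- The `n`-th term `‖f⁽ⁿ⁾‖_∞ / Mₙ` of the norm series. -/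
def term (M : WeightSequence) (f : X → ℂ) (n : ℕ) : ℝ := supNorm (der^[n] f) / M.seq n

lemma term_nonneg (f : X → ℂ) (n : ℕ) : 0 ≤ term M f n :=
  div_nonneg (supNorm_nonneg _) (M.pos n).le

lemma term_const (c : ℂ) (n : ℕ) (hn : n ≠ 0) : term M (fun _ : X => c) n = 0 := by
  rw [term, iterate_der_const c n hn]
  simp [supNorm]

lemma summable_term_const (c : ℂ) : Summable (term M (fun _ : X => c)) :=
  summable_of_ne_finset_zero (s := {0}) fun n hn => term_const c n (by simpa using hn)

lemma term_add_le [CompactSpace X] {f g : X → ℂ} (hf : Smooth f) (hg : Smooth g) (n : ℕ) :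
    term M (f + g) n ≤ term M f n + term M g n := by
  rw [term, term, term, ← add_div]
  refine div_le_div_of_nonneg_right ?_ (M.pos n).le
  refine supNorm_le (add_nonneg (supNorm_nonneg _) (supNorm_nonneg _)) fun x => ?_
  rw [iterate_der_add hf hg]
  exact (norm_add_le _ _).trans (add_le_add (le_supNorm (DiffAt.continuous (hf n)) x)
    (le_supNorm (DiffAt.continuous (hg n)) x))

lemma term_mul_le [CompactSpace X] {f g : X → ℂ} (hf : Smooth f) (hg : Smooth g) (n : ℕ) :
    term M (f * g) n ≤ ∑ p ∈ Finset.HasAntidiagonal.antidiagonal n, term M f p.1 * term M g p.2 := by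
  have hnn : ∀ p : ℕ × ℕ, 0 ≤ term M f p.1 * term M g p.2 := fun p =>
    mul_nonneg (term_nonneg _ _) (term_nonneg _ _)
  rw [term, div_le_iff₀ (M.pos n), Finset.sum_mul]
  refine supNorm_le (Finset.sum_nonneg fun p _ => mul_nonneg (hnn p) (M.pos n).le) fun x => ?_
  rw [iterate_der_mul hf hg, Finset.sum_apply]
  refine (norm_sum_le _ _).trans (Finset.sum_le_sum fun p hp => ?_)
  have hp' : p.1 + p.2 = n := Finset.HasAntidiagonal.mem_antidiagonal.1 hp
  have hw := M.choose_le p.1 p.2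
  rw [le_div_iff₀ (mul_pos (M.pos _) (M.pos _)), hp'] at hw
  have hch : n.choose p.1 = n.choose p.2 := Nat.choose_symm_of_eq_add hp'.symm
  have h1 := le_supNorm (DiffAt.continuous (hf p.1)) x
  have h2 := le_supNorm (DiffAt.continuous (hg p.2)) x
  have hM1 := M.pos p.1
  have hM2 := M.pos p.2
  calc ‖((n.choose p.1 : ℂ) • (der^[p.1] f * der^[p.2] g)) x‖
      = (n.choose p.2 : ℝ) * (‖(der^[p.1] f) x‖ * ‖(der^[p.2] g) x‖) := by
        simp [hch]
    _ ≤ (n.choose p.2 : ℝ) * (supNorm (der^[p.1] f) * supNorm (der^[p.2] g)) := by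
        gcongr
        exact supNorm_nonneg _
    _ = (n.choose p.2 : ℝ) * (M.seq p.1 * M.seq p.2) * (term M f p.1 * term M g p.2) := by
        simp only [term]
        field_simp
    _ ≤ M.seq n * (term M f p.1 * term M g p.2) := mul_le_mul_of_nonneg_right hw (hnn p)
    _ = term M f p.1 * term M g p.2 * M.seq n := mul_comm _ _

lemma summable_antidiagonal {f g : X → ℂ} (hf : Summable (term M f))
    (hg : Summable (term M g)) :
    Summable fun n => ∑ p ∈ Finset.HasAntidiagonal.antidiagonal n, term M f p.1 * term M g p.2 :=
  (summable_norm_sum_mul_antidiagonal_of_summable_norm hf.norm hg.norm).of_norm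

variable (X M)

/-- `D(X, M)` as an algebra of functions on `X`, with pointwise operations. -/
def subalgebra [CompactSpace X] : Subalgebra ℂ (X → ℂ) where
  carrier := {f | Smooth f ∧ Summable (term M f)}
  add_mem' := fun hf hg => ⟨hf.1.add hg.1, Summable.of_nonneg_of_le (term_nonneg _)
    (term_add_le hf.1 hg.1) (hf.2.add hg.2)⟩
  mul_mem' := fun hf hg => ⟨hf.1.mul hg.1, Summable.of_nonneg_of_le (term_nonneg _)
    (term_mul_le hf.1 hg.1) (summable_antidiagonal hf.2 hg.2)⟩
  algebraMap_mem' := fun c => ⟨Smooth.const c, summable_term_const c⟩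

end DalesDavie

open PlaneSet DalesDavie in
/-- The Dales–Davie algebra `D(X, M)`: the infinitely differentiable functions `f` on `X` with
`∑ ‖f⁽ⁿ⁾‖_∞ / Mₙ < ∞`. -/
def DalesDavieAlgebra (X : Set ℂ) [CompactSpace X] (M : WeightSequence) : Type :=
  DalesDavie.subalgebra X M

namespace DalesDavieAlgebra

open PlaneSet DalesDavie

variable {X : Set ℂ} [CompactSpace X] {M : WeightSequence}

instance : CommRing (DalesDavieAlgebra X M) := inferInstanceAs (CommRing (subalgebra X M))

instance : Algebra ℂ (DalesDavieAlgebra X M) := inferInstanceAs (Algebra ℂ (subalgebra X M))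

instance : CoeFun (DalesDavieAlgebra X M) (fun _ => X → ℂ) := ⟨fun f => f.1⟩

@[ext] lemma ext {f g : DalesDavieAlgebra X M} (h : ∀ x, f x = g x) : f = g :=
  Subtype.ext (funext h)

lemma smooth (f : DalesDavieAlgebra X M) : Smooth f.1 :=
  (show Smooth f.1 ∧ Summable (term M f.1) from f.2).1

lemma summable (f : DalesDavieAlgebra X M) : Summable (term M f.1) :=
  (show Smooth f.1 ∧ Summable (term M f.1) from f.2).2

lemma zero_val : (0 : DalesDavieAlgebra X M).1 = fun _ => 0 := rfl
lemma add_val (f g : DalesDavieAlgebra X M) : (f + g).1 = f.1 + g.1 := rfl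
lemma mul_val (f g : DalesDavieAlgebra X M) : (f * g).1 = f.1 * g.1 := rfl
lemma smul_val (c : ℂ) (f : DalesDavieAlgebra X M) : (c • f).1 = (fun _ => c) * f.1 := rfl
lemma neg_val (f : DalesDavieAlgebra X M) : (-f).1 = (fun _ => -1) * f.1 := by
  funext x
  change -(f.1 x) = -1 * f.1 x
  ring

/-- The norm `‖f‖_D = ∑ ‖f⁽ⁿ⁾‖_∞ / Mₙ`. -/
def dnorm (f : DalesDavieAlgebra X M) : ℝ := ∑' n : ℕ, supNorm (der^[n] f.1) / M.seq n

lemma dnorm_nonneg (f : DalesDavieAlgebra X M) : 0 ≤ dnorm f :=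
  tsum_nonneg fun n => term_nonneg (M := M) f.1 n

lemma dnorm_mul_le (f g : DalesDavieAlgebra X M) : dnorm (f * g) ≤ dnorm f * dnorm g := by
  have h := tsum_mul_tsum_eq_tsum_sum_antidiagonal_of_summable_norm f.summable.norm g.summable.norm
  refine le_trans ?_ h.symm.le
  exact Summable.tsum_le_tsum (term_mul_le f.smooth g.smooth) (f * g).summable
    (summable_antidiagonal f.summable g.summable)

lemma dnorm_smul_le (c : ℂ) (f : DalesDavieAlgebra X M) : dnorm (c • f) ≤ ‖c‖ * dnorm f := by
  have h := dnorm_mul_le (algebraMap ℂ (DalesDavieAlgebra X M) c) f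
  rw [← Algebra.smul_def] at h
  refine h.trans (mul_le_mul_of_nonneg_right ?_ (dnorm_nonneg f))
  have h1 : dnorm (algebraMap ℂ (DalesDavieAlgebra X M) c) = term M (fun _ : X => c) 0 :=
    tsum_eq_single 0 fun n hn => term_const c n hn
  rw [h1, term, M.zero, div_one]
  exact supNorm_le (norm_nonneg c) fun _ => le_rfl

/-- The norm as a ring norm. -/
def ringNorm (X : Set ℂ) [CompactSpace X] (M : WeightSequence) :
    RingNorm (DalesDavieAlgebra X M) where
  toFun := dnorm
  map_zero' := by
    have h := dnorm_smul_le (0 : ℂ) (0 : DalesDavieAlgebra X M)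
    simp only [smul_zero, norm_zero, zero_mul] at h
    exact le_antisymm h (dnorm_nonneg _)
  add_le' f g := by
    have h := Summable.tsum_le_tsum (term_add_le (M := M) f.smooth g.smooth) (f + g).summable
      (f.summable.add g.summable)
    rwa [f.summable.tsum_add g.summable] at h
  neg' f := by
    have key : ∀ f : DalesDavieAlgebra X M, dnorm (-f) ≤ dnorm f := fun f => by
      have h := dnorm_smul_le (-1 : ℂ) f
      simpa using h
    refine le_antisymm (key f) ?_
    simpa using key (-f)
  mul_le' := dnorm_mul_le
  eq_zero_of_map_eq_zero' f hf := by
    have h0 : term M f.1 0 ≤ dnorm f := f.summable.le_tsum 0 fun n _ => term_nonneg _ n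
    rw [hf, term, M.zero, div_one] at h0
    ext x
    have hx := (le_supNorm (DiffAt.continuous (f.smooth 0)) x).trans h0
    exact norm_le_zero_iff.1 hx

instance : NormedCommRing (DalesDavieAlgebra X M) :=
  { RingNorm.toNormedRing (ringNorm X M) with mul_comm := mul_comm }

instance : NormedAlgebra ℂ (DalesDavieAlgebra X M) where
  norm_smul_le := dnorm_smul_le

lemma norm_def (f : DalesDavieAlgebra X M) :
    ‖f‖ = ∑' n : ℕ, supNorm (der^[n] f.1) / M.seq n := rfl

/-- The endomorphism `T` of `D(X, M)` is induced by the selfmap `φ` of `X`: `T f = f ∘ φ`. -/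
def IsInducedBy (T : DalesDavieAlgebra X M →A[ℂ] DalesDavieAlgebra X M) (φ : X → X) : Prop :=
  ∀ (f : DalesDavieAlgebra X M) (x : X), T f x = f (φ x)

end DalesDavieAlgebra

end

/-! Let a = φ'(x₀) at a fixed point x₀. If f has leading term c(w - x₀)^k at x₀, then f ∘ φ has
leading term a^k c(w - x₀)^k (`HasLeadingTerm.comp`). So T is formally triangular on Taylor
expansions at x₀, with diagonal 1, a, a², .... To turn this into a statement on the spectrum one
needs |a| < 1 and the absence of flat eigenfunctions.

Both, and the fixed point itself, come from one estimate: T^n converges geometrically in norm to a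
rank one projection onto the constants, which is evaluation at x₀. Since X is connected, fixed
functions are constant (`eq_of_fixed`) and 1 is the only spectral value of modulus at least 1
(`eq_one_of_mem_spectrum`). Subtracting the projection leaves an operator with spectrum in the open
disc, and Gelfand's formula gives the decay. The formula is applied to the transpose on the dual
space, so completeness of D(X,M) is not needed.

For the coordinate function the estimate makes all orbits of φ converge to one point and forces |a|
< 1 (`norm_der_lt_one`). A flat eigenfunction would decay along orbits faster than the powers of its
eigenvalue (`eq_zero_of_flat`). Hence the order of the leading term of a generalized eigenvector
determines its eigenvalue and conversely, which gives multiplicity one. Taylor expansions come from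
uniform regularity, by a mean value inequality along paths. -/

noncomputable section

/-! ## The mean value inequality and Taylor expansions -/

namespace PlaneSet

open Asymptotics

variable {X : Set ℂ}

/-- The mean value inequality along a path in `X`. -/
lemma edist_le_mul_pathLength {G G' : ℂ → ℂ} (hG : ∀ x ∈ X, HasDerivWithinAt G (G' x) X x)
    {z w : X} (γ : Path z w) {K : NNReal} (hK : ∀ t, ‖G' (γ t)‖₊ < K) :
    edist (G w) (G z) ≤ K * pathLength γ := by
  set f : unitInterval → ℂ := fun t => ((γ t : X) : ℂ) with hf
  have hfc : Continuous f := continuous_subtype_val.comp γ.continuous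
  have hloc : ∀ t : unitInterval, ∀ᶠ s in 𝓝 t,
      edist (G (f s)) (G (f t)) ≤ K * edist (f s) (f t) := by
    intro t
    -- The strict gap below `K` absorbs the error term of the difference quotient.
    have hε : 0 < (K : ℝ) - ‖G' (γ t)‖ := sub_pos.2 (hK t)
    have h1 := (hG _ (γ t).2).isLittleO.def hε
    have h2 : Tendsto f (𝓝 t) (𝓝[X] (γ t : ℂ)) :=
      tendsto_nhdsWithin_iff.2 ⟨hfc.tendsto t, Eventually.of_forall fun s => (γ s).2⟩
    filter_upwards [h2.eventually h1] with s hs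
    rw [edist_nndist, edist_nndist, ← ENNReal.coe_mul, ENNReal.coe_le_coe, ← NNReal.coe_le_coe,
      NNReal.coe_mul, coe_nndist, coe_nndist, dist_eq_norm, dist_eq_norm]
    have h3 := norm_add_le (G (f s) - G (f t) - (f s - f t) • G' (γ t)) ((f s - f t) • G' (γ t))
    rw [sub_add_cancel, norm_smul] at h3
    change ‖G (f s) - G (f t) - (f s - f t) • G' (γ t)‖ ≤ _ * ‖f s - f t‖ at hs
    nlinarith
  set V : unitInterval → unitInterval → ENNReal :=
    fun a b => eVariationOn f (Set.univ ∩ Set.Icc a b) with hV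
  have hVadd : ∀ {a b c}, a ≤ b → b ≤ c → V a b + V b c = V a c := fun hab hbc =>
    eVariationOn.Icc_add_Icc f hab hbc (Set.mem_univ _)
  have hVle : ∀ {a b}, a ≤ b → edist (f b) (f a) ≤ V a b := fun {a b} hab =>
    eVariationOn.edist_le f (s := Set.univ ∩ Set.Icc a b) (by simpa using hab) (by simpa using hab)
  -- Continuous induction: this set is clopen in the connected interval, so only additivity of the
  -- variation is used, no integral.
  set S : Set unitInterval := {t | ∀ s ≤ t, edist (G (f s)) (G (f 0)) ≤ K * V 0 s} with hS
  have hstep : ∀ {a b}, a ≤ b → edist (G (f a)) (G (f 0)) ≤ K * V 0 a →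
      edist (G (f b)) (G (f a)) ≤ K * edist (f b) (f a) →
      edist (G (f b)) (G (f 0)) ≤ K * V 0 b := by
    intro a b hab h1 h2
    calc edist (G (f b)) (G (f 0)) ≤ edist (G (f b)) (G (f a)) + edist (G (f a)) (G (f 0)) :=
          edist_triangle _ _ _
      _ ≤ K * V a b + K * V 0 a := add_le_add (h2.trans (by gcongr; exact hVle hab)) h1
      _ = K * V 0 b := by rw [← mul_add, add_comm, hVadd (a := 0) unitInterval.nonneg' hab]
  have hopen : IsOpen S := by
    rw [isOpen_iff_mem_nhds]
    intro t ht
    obtain ⟨U, hU, hUo, htU⟩ := eventually_nhds_iff.1 (hloc t)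
    have hord : ∀ᶠ s in 𝓝 t, ∀ u ∈ Set.Icc t s, u ∈ U := by
      have h1 : Tendsto (fun s => Set.Icc t s) (𝓝 t) (𝓝 t).smallSets :=
        tendsto_const_nhds.Icc tendsto_id
      have h2 := h1.eventually (eventually_smallSets_subset.2 (hUo.mem_nhds htU))
      exact h2
    filter_upwards [hord] with s hs u hu
    rcases le_total u t with h | h
    · exact ht u h
    · exact hstep h (ht t le_rfl) (hU u (hs u ⟨h, hu⟩))
  have hclosed : IsClosed S := by
    refine isClosed_of_closure_subset fun t ht => ?_
    rw [mem_closure_iff_frequently] at ht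
    intro u hu
    rcases hu.lt_or_eq with h | rfl
    · obtain ⟨s, hs, hus⟩ := (ht.and_eventually (lt_mem_nhds h)).exists
      exact hs u hus.le
    · obtain ⟨s, hs, hus⟩ := (ht.and_eventually (hloc u)).exists
      rcases le_total u s with h | h
      · exact hs u h
      · refine hstep h (hs s le_rfl) ?_
        rwa [edist_comm, edist_comm (f u)]
  have h0 : (0 : unitInterval) ∈ S := by
    intro s hs
    obtain rfl : s = 0 := le_antisymm hs bot_le
    simp
  have huniv : S = Set.univ := IsClopen.eq_univ ⟨hclosed, hopen⟩ ⟨0, h0⟩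
  have h1 : (1 : unitInterval) ∈ S := huniv ▸ Set.mem_univ _
  have h2 := h1 1 le_rfl
  simp only [hf, γ.source, γ.target] at h2
  refine h2.trans ?_
  gcongr
  exact eVariationOn.mono f Set.inter_subset_left

/-- In a uniformly regular set, two points are joined by paths of length at most a constant
multiple of their distance. -/
lemma exists_path_le (hreg : UniformlyRegular X) : ∃ B : NNReal, ∀ z w : X, ∃ γ : Path z w,
    pathLength γ ≤ B * edist (z : ℂ) (w : ℂ) := by
  obtain ⟨C, hC⟩ := hreg.2
  -- The infimum of the lengths need not be attained; the extra 1 leaves room strictly above it when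
  -- z ≠ w.
  refine ⟨C + 1, fun z w => ?_⟩
  by_cases hzw : z = w
  · subst hzw
    refine ⟨Path.refl z, ?_⟩
    have : pathLength (Path.refl z) = 0 := by
      refine eVariationOn.constant_on ?_
      rintro _ ⟨s, -, rfl⟩ _ ⟨t, -, rfl⟩
      simp
    simp [this]
  · have hpos : edist (z : ℂ) (w : ℂ) ≠ 0 := by
      exact fun h => hzw (Subtype.ext (edist_eq_zero.1 h))
    have hlt : geodesicDist X z w < (C + 1 : NNReal) * edist (z : ℂ) (w : ℂ) := by
      refine (hC z w).trans_lt ?_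
      rw [ENNReal.coe_add, add_mul, ENNReal.coe_one, one_mul]
      exact ENNReal.lt_add_right (ENNReal.mul_ne_top ENNReal.coe_ne_top (edist_ne_top _ _)) hpos
    obtain ⟨γ, hγ⟩ := iInf_lt_iff.1 hlt
    exact ⟨γ, hγ.le⟩

/-- Integration of little-o estimates. -/
lemma isLittleO_of_hasDerivWithinAt (hreg : UniformlyRegular X) {G G' : ℂ → ℂ}
    (hG : ∀ x ∈ X, HasDerivWithinAt G (G' x) X x) (x₀ : X) (h0 : G x₀ = 0) {k : ℕ}
    (hG' : (fun w : X => G' w) =o[𝓝 x₀] fun w : X => ((w : ℂ) - x₀) ^ k) :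
    (fun w : X => G w) =o[𝓝 x₀] fun w : X => ((w : ℂ) - x₀) ^ (k + 1) := by
  obtain ⟨B, hB⟩ := exists_path_le hreg
  rw [isLittleO_iff]
  intro ε hε
  -- A path of length at most B r from x₀ stays within B r of x₀, so a bound of order r^k on the
  -- derivative integrates to order r^(k+1). The factor 2 makes the derivative bound strict; `B + 1`
  -- is positive even if `B = 0`.
  set η : ℝ := ε / (2 * ((B : ℝ) + 1) ^ (k + 1)) with hη
  have hB1 : 0 < (B : ℝ) + 1 := by positivity
  have hηpos : 0 < η := by positivity
  obtain ⟨δ, hδ, hball⟩ := Metric.eventually_nhds_iff.1 (hG'.def hηpos)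
  have hδ' : 0 < δ / ((B : ℝ) + 1) := by positivity
  filter_upwards [Metric.ball_mem_nhds x₀ hδ'] with w hw
  rw [Metric.mem_ball, lt_div_iff₀ hB1, Subtype.dist_eq, dist_eq_norm] at hw
  by_cases hwx : (w : ℂ) = x₀
  · simp [hwx, h0]
  have hr : 0 < ‖(w : ℂ) - x₀‖ := norm_pos_iff.2 (sub_ne_zero.2 hwx)
  obtain ⟨γ, hγ⟩ := hB x₀ w
  set r := ‖(w : ℂ) - x₀‖ with hrdef
  have hed : edist (x₀ : ℂ) (w : ℂ) = ENNReal.ofReal r := by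
    rw [edist_comm, edist_dist, dist_eq_norm]
  have hγ' : pathLength γ ≤ ENNReal.ofReal (B * r) := by
    rw [ENNReal.ofReal_mul (NNReal.coe_nonneg B), ENNReal.ofReal_coe_nnreal, ← hed]
    exact hγ
  have hdist : ∀ t, ‖((γ t : X) : ℂ) - x₀‖ ≤ B * r := by
    intro t
    have h1 := (eVariationOn.edist_le (fun t : unitInterval => ((γ t : X) : ℂ))
      (Set.mem_univ t) (Set.mem_univ 0)).trans hγ'
    rw [edist_dist, γ.source, ENNReal.ofReal_le_ofReal_iff (by positivity), dist_eq_norm] at h1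
    exact h1
  set K : NNReal := ⟨2 * η * ((B + 1) * r) ^ k, by positivity⟩ with hK
  have hKb : ∀ t, ‖G' (γ t)‖₊ < K := by
    intro t
    rw [← NNReal.coe_lt_coe, coe_nnnorm]
    have h1 : dist (γ t) x₀ < δ := by
      rw [Subtype.dist_eq, dist_eq_norm]
      refine (hdist t).trans_lt (lt_of_le_of_lt ?_ hw)
      nlinarith
    have h2 := hball h1
    rw [norm_pow] at h2
    have h3 : ‖((γ t : X) : ℂ) - x₀‖ ^ k ≤ ((B + 1) * r) ^ k := by
      gcongr
      exact (hdist t).trans (by nlinarith)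
    calc ‖G' (γ t)‖ ≤ η * ((B + 1) * r) ^ k := h2.trans (by gcongr)
      _ < 2 * η * ((B + 1) * r) ^ k := by
        have : 0 < η * ((B + 1) * r) ^ k := by positivity
        linarith
      _ = K := rfl
  have hmain := (edist_le_mul_pathLength hG γ hKb).trans (mul_le_mul_right hγ' _)
  rw [h0, edist_zero_right, ← ofReal_norm, ← ENNReal.ofReal_coe_nnreal,
    ← ENNReal.ofReal_mul (NNReal.coe_nonneg K), ENNReal.ofReal_le_ofReal_iff (by positivity)] at hmain
  refine hmain.trans ?_
  rw [norm_pow, ← hrdef]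
  calc (K : ℝ) * (B * r) ≤ 2 * η * ((B + 1) * r) ^ k * ((B + 1) * r) := by
        change 2 * η * ((B + 1) * r) ^ k * (B * r) ≤ _
        gcongr
        linarith
    _ = ε * r ^ (k + 1) := by
        rw [hη, mul_assoc, ← pow_succ, mul_pow]
        field_simp

/-- The Taylor expansion of a smooth function at a point of a uniformly regular set. -/
lemma exists_taylor (hreg : UniformlyRegular X) (x₀ : X) (k : ℕ) {f : X → ℂ} (hf : Smooth f) :
    ∃ c : ℕ → ℂ, (fun w : X => f w - ∑ i ∈ Finset.range (k + 1), c i * ((w : ℂ) - x₀) ^ i)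
      =o[𝓝 x₀] fun w : X => ((w : ℂ) - x₀) ^ k := by
  induction k generalizing f with
  | zero =>
    refine ⟨fun _ => f x₀, ?_⟩
    have h := (DiffAt.continuous (hf 0)).tendsto x₀
    simp only [zero_add, Finset.range_one, Finset.sum_singleton, pow_zero, mul_one]
    rw [isLittleO_one_iff]
    simpa using h.sub_const (f x₀)
  | succ k ih =>
    -- The expansion of f' is integrated termwise: the remainder for f has the remainder for f' as
    -- its derivative.
    obtain ⟨d, hd⟩ := ih hf.der
    set G : ℂ → ℂ := fun z => zeroExt f z - (f x₀ +
      ∑ i ∈ Finset.range (k + 1), d i / (i + 1) * (z - x₀) ^ (i + 1)) with hGdef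
    set G' : ℂ → ℂ := fun z => zeroExt (der f) z -
      ∑ i ∈ Finset.range (k + 1), d i * (z - x₀) ^ i with hG'def
    have hG : ∀ x ∈ X, HasDerivWithinAt G (G' x) X x := by
      intro x hx
      have h1 : HasDerivWithinAt (zeroExt f) (zeroExt (der f) x) X x := by
        have := DifferentiableWithinAt.hasDerivWithinAt (hf 0 ⟨x, hx⟩)
        have h2 := zeroExt_coe (der f) ⟨x, hx⟩
        rw [h2]
        exact this
      refine h1.sub (HasDerivAt.hasDerivWithinAt (HasDerivAt.const_add _
        (HasDerivAt.fun_sum fun i _ => ?_)))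
      have h3 := (((hasDerivAt_id x).sub_const (x₀ : ℂ)).pow (i + 1)).const_mul (d i / (i + 1))
      have h4 : (i : ℂ) + 1 ≠ 0 := Nat.cast_add_one_ne_zero i
      refine HasDerivAt.congr_deriv (f := fun z : ℂ => d i / (i + 1) * (z - x₀) ^ (i + 1)) h3 ?_
      simp only [Nat.cast_add, Nat.cast_one, id_eq, add_tsub_cancel_right, mul_one]
      field_simp
    have h0 : G x₀ = 0 := by simp [hGdef]
    have key := isLittleO_of_hasDerivWithinAt hreg hG x₀ h0 (k := k)
      (by simpa only [hG'def, zeroExt_coe] using hd)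
    refine ⟨fun i => i.casesOn (f x₀) fun j => d j / (j + 1), ?_⟩
    convert key using 2 with w
    rw [Finset.sum_range_succ']
    simp only [hGdef, zeroExt_coe, pow_zero, mul_one]
    rw [add_comm (f x₀)]
    rfl

/-! ## Leading terms -/

/-- `f w = c (w - x₀) ^ k + o((w - x₀) ^ k)` as `w → x₀` in `X`. -/
def HasLeadingTerm (x₀ : X) (k : ℕ) (f : X → ℂ) (c : ℂ) : Prop :=
  (fun w : X => f w - c * ((w : ℂ) - x₀) ^ k) =o[𝓝 x₀] fun w : X => ((w : ℂ) - x₀) ^ k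

namespace HasLeadingTerm

variable {x₀ : X} {f g : X → ℂ} {c d : ℂ} {k m : ℕ}

lemma isBigO (hf : HasLeadingTerm x₀ k f c) : f =O[𝓝 x₀] fun w : X => ((w : ℂ) - x₀) ^ k := by
  have h := (IsLittleO.isBigO hf).add ((isBigO_refl (fun w : X => ((w : ℂ) - x₀) ^ k) (𝓝 x₀)).const_mul_left c)
  exact h.congr_left fun w => by ring

lemma add (hf : HasLeadingTerm x₀ k f c) (hg : HasLeadingTerm x₀ k g d) :
    HasLeadingTerm x₀ k (f + g) (c + d) := by
  refine (IsLittleO.add hf hg).congr_left fun w => ?_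
  simp only [Pi.add_apply]
  ring

lemma const_mul (hf : HasLeadingTerm x₀ k f c) (b : ℂ) :
    HasLeadingTerm x₀ k (fun w => b * f w) (b * c) := by
  refine (IsLittleO.const_mul_left hf b).congr_left fun w => ?_
  ring

lemma tendsto_sub (x₀ : X) : Tendsto (fun w : X => (w : ℂ) - x₀) (𝓝 x₀) (𝓝 0) := by
  have h : Continuous fun w : X => (w : ℂ) - x₀ := by fun_prop
  simpa using h.tendsto x₀

lemma pow_isLittleO (x₀ : X) (h : m < k) :
    (fun w : X => ((w : ℂ) - x₀) ^ k) =o[𝓝 x₀] fun w : X => ((w : ℂ) - x₀) ^ m :=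
  (isLittleO_pow_pow h).comp_tendsto (tendsto_sub x₀)

lemma mul (hf : HasLeadingTerm x₀ k f c) (hg : HasLeadingTerm x₀ m g d) :
    HasLeadingTerm x₀ (k + m) (f * g) (c * d) := by
  have h1 := IsLittleO.mul_isBigO hf hg.isBigO
  have h2 := ((isBigO_refl (fun w : X => ((w : ℂ) - x₀) ^ k) (𝓝 x₀)).const_mul_left c).mul_isLittleO
    (show _ =o[𝓝 x₀] _ from hg)
  have h3 := h1.add h2
  simp only [← pow_add] at h3
  refine h3.congr_left fun w => ?_
  simp only [Pi.mul_apply, pow_add]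
  ring

lemma one (x₀ : X) : HasLeadingTerm x₀ 0 (fun _ => 1) 1 := by
  simp [HasLeadingTerm]

lemma pow (hf : HasLeadingTerm x₀ k f c) (n : ℕ) : HasLeadingTerm x₀ (k * n) (f ^ n) (c ^ n) := by
  induction n with
  | zero => rw [mul_zero, pow_zero, pow_zero]; exact one x₀
  | succ n ih => simpa only [pow_succ, Nat.mul_succ] using ih.mul hf

/-- At an isolated point both functions vanish for k ≥ 1, so x₀ has to be a limit point. -/
lemma eq_of_isLittleO [(𝓝[≠] x₀).NeBot]
    (h : (fun w : X => c * ((w : ℂ) - x₀) ^ k) =o[𝓝 x₀] fun w : X => ((w : ℂ) - x₀) ^ k) :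
    c = 0 := by
  by_contra hc
  have h1 := (h.mono nhdsWithin_le_nhds : _ =o[𝓝[≠] x₀] _).def
    (show 0 < ‖c‖ / 2 by have := norm_pos_iff.2 hc; positivity)
  obtain ⟨w, hw, hne⟩ := (h1.and self_mem_nhdsWithin).exists
  have hpos : 0 < ‖((w : ℂ) - x₀) ^ k‖ :=
    norm_pos_iff.2 (pow_ne_zero _ (sub_ne_zero.2 fun e => hne (Subtype.ext e)))
  have hc' := norm_pos_iff.2 hc
  rw [norm_mul] at hw
  nlinarith

lemma unique [(𝓝[≠] x₀).NeBot] (hf : HasLeadingTerm x₀ k f c) (hf' : HasLeadingTerm x₀ k f d) :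
    c = d := by
  have h : (fun w : X => (c - d) * ((w : ℂ) - x₀) ^ k) =o[𝓝 x₀] fun w : X => ((w : ℂ) - x₀) ^ k :=
    (IsLittleO.sub hf' hf).congr_left fun w => by ring
  exact sub_eq_zero.1 (eq_of_isLittleO h)

/-- A zero coefficient is allowed and says only that f is o((w - x₀)^m). Flatness is this at every
order. -/
lemma zero_of_lt (hf : HasLeadingTerm x₀ k f c) (h : m < k) : HasLeadingTerm x₀ m f 0 := by
  have := hf.isBigO.trans_isLittleO (pow_isLittleO x₀ h)
  simpa [HasLeadingTerm] using this

lemma order_unique [(𝓝[≠] x₀).NeBot] (hf : HasLeadingTerm x₀ k f c) (hc : c ≠ 0)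
    (hf' : HasLeadingTerm x₀ m f d) (hd : d ≠ 0) : k = m := by
  rcases lt_trichotomy k m with h | h | h
  · exact absurd (hf.unique (hf'.zero_of_lt h)) hc
  · exact h
  · exact absurd (hf'.unique (hf.zero_of_lt h)) hd

/-- The expansion φ(w) - x₀ = a(w - x₀) + o(w - x₀) is raised to the power k and substituted. -/
lemma comp {φ : X → X} {a : ℂ} (hf : HasLeadingTerm x₀ k f c) (hφ : φ x₀ = x₀)
    (hc : Continuous φ) (hlead : HasLeadingTerm x₀ 1 (fun w => (φ w : ℂ) - x₀) a) :
    HasLeadingTerm x₀ k (f ∘ φ) (a ^ k * c) := by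
  have ht : Tendsto φ (𝓝 x₀) (𝓝 x₀) := by simpa [hφ] using hc.tendsto x₀
  have h1 := IsLittleO.comp_tendsto hf ht
  have h2 := hlead.pow k
  rw [one_mul] at h2
  have h3 := (h1.trans_isBigO h2.isBigO).add (IsLittleO.const_mul_left h2 c)
  refine h3.congr_left fun w => ?_
  simp only [Function.comp, Pi.pow_apply]
  ring

lemma hasDerivWithinAt (hf : HasLeadingTerm x₀ 1 (fun w => f w - f x₀) c) :
    HasDerivWithinAt (zeroExt f) c X x₀ := by
  rw [hasDerivWithinAt_iff_isLittleO, ← map_nhds_subtype_val, isLittleO_map]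
  refine (IsLittleO.congr hf (fun w => ?_) fun w => ?_)
  · simp only [Function.comp, zeroExt_coe, smul_eq_mul]
    ring
  · simp

lemma of_diffAt (hf : DiffAt f x₀) : HasLeadingTerm x₀ 1 (fun w => f w - f x₀) (der f x₀) := by
  have h := (DifferentiableWithinAt.hasDerivWithinAt hf).isLittleO
  rw [← map_nhds_subtype_val, isLittleO_map] at h
  refine h.congr (fun w => ?_) fun w => ?_
  · simp only [Function.comp, zeroExt_coe, smul_eq_mul, der]
    ring
  · simp

end HasLeadingTerm

/-- A smooth function on a uniformly regular set has a nonzero leading term at a given point or is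
flat there. -/
lemma exists_leadingTerm_or_flat (hreg : UniformlyRegular X) (x₀ : X) {f : X → ℂ}
    (hf : Smooth f) : (∃ m c, c ≠ 0 ∧ HasLeadingTerm x₀ m f c) ∨ ∀ k, HasLeadingTerm x₀ k f 0 := by
  classical
  rw [or_iff_not_imp_left]
  intro hno k
  obtain ⟨c, hc⟩ := exists_taylor hreg x₀ k hf
  -- The first nonzero Taylor coefficient would provide a leading term.
  have hzero : ∀ i ∈ Finset.range (k + 1), c i = 0 := by
    by_contra! hex
    obtain ⟨hmem, hne⟩ := Nat.find_spec hex
    set m := Nat.find hex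
    have hmk : m ≤ k := by simpa [Nat.lt_succ_iff] using hmem
    refine hno ⟨m, c m, hne, ?_⟩
    have h1 : (fun w : X => ∑ i ∈ (Finset.range (k + 1)).erase m, c i * ((w : ℂ) - x₀) ^ i)
        =o[𝓝 x₀] fun w : X => ((w : ℂ) - x₀) ^ m := by
      refine IsLittleO.fun_sum fun i hi => ?_
      obtain ⟨him, hik⟩ := Finset.mem_erase.1 hi
      rcases lt_or_gt_of_ne him with h | h
      · have : c i = 0 := by
          by_contra hci
          exact Nat.find_min hex h ⟨hik, hci⟩
        simp [this]
      · exact (HasLeadingTerm.pow_isLittleO x₀ h).const_mul_left _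
    have h2 : (fun w : X => ((w : ℂ) - x₀) ^ k) =O[𝓝 x₀] fun w : X => ((w : ℂ) - x₀) ^ m := by
      rcases hmk.lt_or_eq with h | h
      · exact (HasLeadingTerm.pow_isLittleO x₀ h).isBigO
      · rw [← h]
    refine ((hc.trans_isBigO h2).add h1).congr_left fun w => ?_
    rw [← Finset.add_sum_erase _ _ hmem]
    ring
  refine IsLittleO.congr_left hc fun w => ?_
  rw [Finset.sum_eq_zero fun i hi => by rw [hzero i hi, zero_mul]]
  simp

end PlaneSet

/-! ## Powers of operators whose spectrum lies in the open unit disc -/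

/-- If the spectrum of a bounded operator `A` on a normed space lies in the open unit disc, then the
powers of `A` decay geometrically, provided that the operators are represented on a Banach space by
a linear antihomomorphism that does not decrease norms. -/
lemma exists_norm_pow_le_of_antihom {E F : Type*} [NormedAddCommGroup E] [NormedSpace ℂ E]
    [NormedAddCommGroup F] [NormedSpace ℂ F] [CompleteSpace F] [Nontrivial F]
    (J : (E →L[ℂ] E) →ₗ[ℂ] (F →L[ℂ] F)) (hone : J 1 = 1)
    (hmul : ∀ A B, J (A * B) = J B * J A) (hnorm : ∀ A, ‖A‖ ≤ ‖J A‖)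
    (A : E →L[ℂ] E) (h : ∀ z ∈ spectrum ℂ A, ‖z‖ < 1) :
    ∃ r : ℝ, 0 < r ∧ r < 1 ∧ ∀ᶠ n : ℕ in atTop, ‖A ^ n‖ ≤ r ^ n := by
  have hpow : ∀ n, J (A ^ n) = J A ^ n := by
    intro n
    induction n with
    | zero => rw [pow_zero, pow_zero, hone]
    | succ n ih => rw [pow_succ', hmul, ih, pow_succ]
  -- An antihomomorphism also sends units to units, so the spectrum can only shrink.
  have hspec : spectrum ℂ (J A) ⊆ spectrum ℂ A := by
    intro z hz hu
    rw [spectrum.mem_resolventSet_iff] at hu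
    refine hz ?_
    rw [spectrum.mem_resolventSet_iff]
    have h1 : algebraMap ℂ (F →L[ℂ] F) z - J A = J (algebraMap ℂ (E →L[ℂ] E) z - A) := by
      rw [map_sub, Algebra.algebraMap_eq_smul_one, Algebra.algebraMap_eq_smul_one, map_smul, hone]
    rw [h1]
    obtain ⟨u, hu⟩ := hu
    rw [← hu]
    exact ⟨⟨J u, J ↑u⁻¹, by rw [← hmul, u.inv_mul, hone], by rw [← hmul, u.mul_inv, hone]⟩, rfl⟩
  have hlt : spectralRadius ℂ (J A) < (1 : NNReal) :=
    spectrum.spectralRadius_lt_of_forall_lt _ fun z hz => h z (hspec hz)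
  obtain ⟨r, hr1, hr2⟩ := ENNReal.lt_iff_exists_nnreal_btwn.1 hlt
  rw [ENNReal.coe_lt_coe] at hr2
  have hr0 : 0 < r := ENNReal.coe_pos.1 (bot_le.trans_lt hr1)
  refine ⟨r, hr0, hr2, ?_⟩
  have hG := spectrum.pow_nnnorm_pow_one_div_tendsto_nhds_spectralRadius (J A)
  filter_upwards [hG.eventually (gt_mem_nhds hr1), eventually_gt_atTop 0] with n hn hn0
  have hn' : (0 : ℝ) < n := by exact_mod_cast hn0
  rw [one_div] at hn
  have h1 := ENNReal.rpow_le_rpow hn.le hn'.le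
  rw [ENNReal.rpow_inv_rpow hn'.ne', ENNReal.rpow_natCast, ← ENNReal.coe_pow,
    ENNReal.coe_le_coe] at h1
  refine (hnorm _).trans ?_
  rw [hpow]
  exact_mod_cast h1

/-- If the spectrum of a bounded operator on a normed space, complete or not, lies in the open unit
disc, then its powers decay geometrically. -/
lemma exists_norm_pow_le_of_spectrum {E : Type*} [NormedAddCommGroup E] [NormedSpace ℂ E]
    [Nontrivial E] (A : E →L[ℂ] E) (h : ∀ z ∈ spectrum ℂ A, ‖z‖ < 1) :
    ∃ r : ℝ, 0 < r ∧ r < 1 ∧ ∀ᶠ n : ℕ in atTop, ‖A ^ n‖ ≤ r ^ n := by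
  have : Nontrivial (E →L[ℂ] ℂ) := by
    obtain ⟨x, hx⟩ := exists_ne (0 : E)
    obtain ⟨ψ, hψ⟩ := SeparatingDual.exists_ne_zero (R := ℂ) hx
    exact ⟨⟨ψ, 0, fun e => hψ (by simp [e])⟩⟩
  -- Operators are sent to their transposes on the dual, which is complete even if `E` is not.
  -- Hahn–Banach gives the norm comparison.
  refine exists_norm_pow_le_of_antihom (F := E →L[ℂ] ℂ)
    ((ContinuousLinearMap.compL ℂ E E ℂ).flip).toLinearMap rfl (fun _ _ => rfl) (fun A => ?_) A h
  set A' : (E →L[ℂ] ℂ) →L[ℂ] (E →L[ℂ] ℂ) := (ContinuousLinearMap.compL ℂ E E ℂ).flip A with hA'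
  change ‖A‖ ≤ ‖A'‖
  refine A.opNorm_le_bound (norm_nonneg A') fun f => ?_
  refine NormedSpace.norm_le_dual_bound ℂ _ (by positivity) fun ψ => ?_
  calc ‖ψ (A f)‖ = ‖A' ψ f‖ := rfl
    _ ≤ ‖A' ψ‖ * ‖f‖ := ContinuousLinearMap.le_opNorm _ _
    _ ≤ ‖A'‖ * ‖ψ‖ * ‖f‖ := by gcongr; exact ContinuousLinearMap.le_opNorm _ _
    _ = ‖A'‖ * ‖f‖ * ‖ψ‖ := by ring

/-! ## Riesz operators with a simple eigenvalue `1` -/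

/-- Let `1` be the only spectral value of modulus at least `1` of a Riesz operator `T`, with
eigenspace spanned by `e`, and suppose that `e` is not in the range of `1 - T`. Then the powers of
`T` converge geometrically to a projection onto the span of `e`. -/
lemma IsRieszOperator.exists_geometric_convergence {E : Type*} [NormedAddCommGroup E]
    [NormedSpace ℂ E] {T : E →L[ℂ] E} (hT : IsRieszOperator T) {e : E} (he0 : e ≠ 0)
    (hTe : T e = e) (hspec : ∀ z ∈ spectrum ℂ T, 1 ≤ ‖z‖ → z = 1)
    (hker : ∀ f, T f = f → ∃ c : ℂ, f = c • e) (hrange : ∀ f, f - T f ≠ e) :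
    ∃ (ξ : StrongDual ℂ E) (r : ℝ), 0 < r ∧ r < 1 ∧
      ∀ᶠ n : ℕ in atTop, ∀ f, ‖(T ^ n) f - ξ f • e‖ ≤ r ^ n * ‖f‖ := by
  set D : E →ₗ[ℂ] E := (1 : ℂ) • LinearMap.id - (T : E →ₗ[ℂ] E) with hD
  have hDapp : ∀ f, D f = f - T f := fun f => by simp [hD]
  set R := LinearMap.range D with hR
  have heR : e ∉ R := by
    rintro ⟨f, hf⟩
    exact hrange f (by rw [← hDapp, hf])
  have hkerfin : Module.finrank ℂ (LinearMap.ker D) = 1 := by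
    have hmem : e ∈ LinearMap.ker D := by rw [LinearMap.mem_ker, hDapp, hTe, sub_self]
    rw [finrank_eq_one_iff_of_nonzero' (⟨e, hmem⟩ : LinearMap.ker D)
      (by simpa [Subtype.ext_iff] using he0)]
    rintro ⟨f, hf⟩
    rw [LinearMap.mem_ker, hDapp, sub_eq_zero] at hf
    obtain ⟨c, hc⟩ := hker f hf.symm
    exact ⟨c, Subtype.ext hc.symm⟩
  have hcoker : Module.finrank ℂ (E ⧸ R) = 1 := by
    rw [← hkerfin]; exact (hT.ker_eq_coker 1 one_ne_zero).symm
  -- The cokernel is a line and `e ∉ R`, so E = R ⊕ ℂe. The functional ξ below is the coordinate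
  -- along `e`, continuous because its kernel `R` is closed.
  have hdecomp : ∀ g, ∃ c : ℂ, g - c • e ∈ R := by
    intro g
    have h1 := (finrank_eq_one_iff_of_nonzero' (R.mkQ e)
      (by rwa [ne_eq, Submodule.mkQ_apply, Submodule.Quotient.mk_eq_zero])).1 hcoker (R.mkQ g)
    obtain ⟨c, hc⟩ := h1
    refine ⟨c, ?_⟩
    rw [← Submodule.Quotient.mk_eq_zero, Submodule.Quotient.mk_sub, Submodule.Quotient.mk_smul,
      sub_eq_zero]
    exact hc.symm
  have hRclosed : IsClosed (R : Set E) := by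
    have h := hT.closed_range 1 one_ne_zero
    have : (R : Set E) = Set.range fun f => (1 : ℂ) • f - T f := by
      ext g; simp [hR, hD]
    rwa [this]
  obtain ⟨ξ, hξe, hξR⟩ : ∃ ξ : StrongDual ℂ E, ξ e = 1 ∧ ∀ g, ξ g = 0 ↔ g ∈ R := by
    obtain ⟨l, hle, hlR⟩ := Submodule.exists_le_ker_of_notMem heR
    have hl : ∀ g, l g = 0 ↔ g ∈ R := by
      refine fun g => ⟨fun hg => ?_, fun hg => hlR hg⟩
      obtain ⟨c, hc⟩ := hdecomp g
      have h1 : l (g - c • e) = 0 := hlR hc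
      rw [map_sub, hg, zero_sub, neg_eq_zero, map_smul, smul_eq_mul, mul_eq_zero] at h1
      rcases h1 with h1 | h1
      · simpa [h1] using hc
      · exact absurd h1 hle
    have hlc : Continuous l := by
      refine LinearMap.continuous_of_isClosed_ker l ?_
      convert hRclosed using 1
      ext g
      exact hl g
    refine ⟨(l e)⁻¹ • ⟨l, hlc⟩, ?_, fun g => ?_⟩
    · change (l e)⁻¹ * l e = 1
      exact inv_mul_cancel₀ hle
    · change (l e)⁻¹ * l g = 0 ↔ _
      rw [mul_eq_zero_iff_left (inv_ne_zero hle), hl]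
  have hξT : ∀ f, ξ (T f) = ξ f := by
    intro f
    have h1 := (hξR (f - T f)).2 ⟨f, hDapp f⟩
    rw [map_sub, sub_eq_zero] at h1
    exact h1.symm
  set P : E →L[ℂ] E := ξ.smulRight e with hP
  have hPapp : ∀ f, P f = ξ f • e := fun f => rfl
  have hTP : T * P = P := by ext f; simp [hPapp, hTe]
  have hPT : P * T = P := by ext f; simp [hPapp, hξT]
  have hPP : P * P = P := by ext f; simp [hPapp, hξe]
  set S := T - P with hS
  -- The exponent has to be positive: for exponent 0 the two sides are 1 and 1 - P.
  have hSpow : ∀ n, S ^ (n + 1) = T ^ (n + 1) - P := by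
    have hTnP : ∀ n, T ^ n * P = P := by
      intro n
      induction n with
      | zero => simp
      | succ n ih => rw [pow_succ, mul_assoc, hTP, ih]
    intro n
    induction n with
    | zero => simp [hS]
    | succ n ih => rw [pow_succ, ih, hS, sub_mul, mul_sub, mul_sub, hTnP, hPT, hPP, ← pow_succ]; simp
  have hSspec : ∀ z ∈ spectrum ℂ S, ‖z‖ < 1 := by
    intro z hz
    by_contra! hz1
    have hz0 : z ≠ 0 := by rintro rfl; simp at hz1; linarith
    refine hz ?_
    rw [spectrum.mem_resolventSet_iff]
    by_cases hone : z = 1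
    · subst hone
      rw [map_one]
      have hSapp : ∀ f, (1 - S : E →L[ℂ] E) f = D f + ξ f • e := fun f => by
        simp [hS, hDapp, hPapp]; abel
      have hinj : Function.Injective (1 - S : E →L[ℂ] E) := by
        rw [injective_iff_map_eq_zero]
        intro f hf
        rw [hSapp] at hf
        have h1 := congrArg ξ hf
        rw [map_add, (hξR (D f)).2 ⟨f, rfl⟩, map_smul, hξe, map_zero] at h1
        have h2 : ξ f = 0 := by simpa using h1
        rw [h2, zero_smul, add_zero, hDapp, sub_eq_zero] at hf
        obtain ⟨c, rfl⟩ := hker f hf.symm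
        rw [map_smul, hξe, smul_eq_mul, mul_one] at h2
        rw [h2, zero_smul]
      have hproj : ∀ g, ξ (g - ξ g • e) = 0 := fun g => by simp [hξe]
      -- On ker ξ the operator 1 - S is 1 - T, and it fixes `e`. The preimage of g is therefore the
      -- projection of f to ker ξ plus the component of g along `e`.
      have hlift : ∀ f g, D f = g - ξ g • e → (1 - S : E →L[ℂ] E) (f - ξ f • e + ξ g • e) = g := by
        intro f g h
        have hDe : D e = 0 := by rw [hDapp, hTe, sub_self]
        rw [hSapp]
        simp [hDe, h, hξe]
      have hsurj : Function.Surjective (1 - S : E →L[ℂ] E) := by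
        intro g
        obtain ⟨f, hf⟩ := (hξR _).1 (hproj g)
        exact ⟨_, hlift f g hf⟩
      let L : E ≃ₗ[ℂ] E := LinearEquiv.ofBijective ((1 - S : E →L[ℂ] E) : E →ₗ[ℂ] E) ⟨hinj, hsurj⟩
      -- The open mapping theorem would need completeness; openness of 1 - T onto its range replaces
      -- it.
      have hLc : Continuous L.symm := by
        refine continuous_of_continuousAt_zero L.symm.toLinearMap.toAddMonoidHom ?_
        change Tendsto L.symm (𝓝 0) (𝓝 (L.symm 0))
        rw [map_zero, Metric.tendsto_nhds_nhds]
        intro ε hε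
        have hcont : Continuous fun p : E × E => p.1 - ξ p.1 • e + ξ p.2 • e := by fun_prop
        have hc0 := hcont.tendsto (0, 0)
        simp only [map_zero, zero_smul, sub_zero, add_zero] at hc0
        obtain ⟨U, hU, V, hV, hUV⟩ := mem_nhds_prod_iff.1 (hc0 (Metric.ball_mem_nhds _ hε))
        have hopen := hT.open_onto_range 1 one_ne_zero
        have h1 := hopen.image_mem_nhds hU
        have h2 : ∀ᶠ g in 𝓝 (0 : E), ∃ f ∈ U, D f = g - ξ g • e := by
          let q : E → Set.range (fun f : E => (1 : ℂ) • f - T f) := fun g => ⟨g - ξ g • e, by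
            obtain ⟨f, hf⟩ := (hξR _).1 (hproj g)
            exact ⟨f, by simpa [hD] using hf⟩⟩
          have hq : Continuous q := by
            refine Continuous.subtype_mk ?_ _
            fun_prop
          have hq0 : q 0 = Set.rangeFactorization (fun f : E => (1 : ℂ) • f - T f) 0 :=
            Subtype.ext (by simp [q])
          rw [← hq0] at h1
          filter_upwards [hq.continuousAt.preimage_mem_nhds h1] with g hg
          obtain ⟨f, hfU, hf⟩ := hg
          refine ⟨f, hfU, ?_⟩
          have := congrArg Subtype.val hf
          simpa [q, hD] using this
        obtain ⟨δ, hδ, hball⟩ := Metric.eventually_nhds_iff.1 (h2.and hV)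
        refine ⟨δ, hδ, fun {g} hg => ?_⟩
        obtain ⟨⟨f, hfU, hf⟩, hgV⟩ := hball hg
        have h3 : L.symm g = f - ξ f • e + ξ g • e := by
          rw [LinearEquiv.symm_apply_eq]
          exact (hlift f g hf).symm
        rw [h3]
        exact hUV (Set.mk_mem_prod hfU hgV)
      let L' : E ≃L[ℂ] E := ⟨L, (1 - S : E →L[ℂ] E).continuous, hLc⟩
      exact ⟨(ContinuousLinearEquiv.unitsEquiv ℂ E).symm L', by ext f; rfl⟩
    · have hu : IsUnit (algebraMap ℂ (E →L[ℂ] E) z - T) := by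
        by_contra hu
        exact hone (hspec z hu hz1)
      obtain ⟨u, hu⟩ := hu
      set ι := algebraMap ℂ (E →L[ℂ] E) with hι
      have hzP : ι z * P = P * ι z := Algebra.commutes z P
      have huP : Commute (u : E →L[ℂ] E) P := by
        rw [hu, Commute, SemiconjBy, sub_mul, mul_sub, hTP, hPT, hzP]
      have huP' := huP.units_inv_left
      have hzS : ι z - S = u + P := by rw [hu, hS]; abel
      have hz' : ι z * ι z⁻¹ = 1 := by rw [← map_mul, mul_inv_cancel₀ hz0, map_one]
      have huPz : (u : E →L[ℂ] E) * P = ι z * P - P := by rw [hu, sub_mul, hTP]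
      have hzc : ∀ A : E →L[ℂ] E, ι z⁻¹ * A = A * ι z⁻¹ := Algebra.commutes z⁻¹
      have hQ : (u + P : E →L[ℂ] E) * (1 - P) = u * (1 - P) := by
        rw [add_mul, mul_sub P, mul_one, hPP, sub_self, add_zero]
      have hQ2 : (u + P : E →L[ℂ] E) * P = ι z * P := by
        rw [add_mul, hPP, huPz, sub_add_cancel]
      -- The operator z - S = u + P is z - T on ker P and multiplication by z on ℂe, which dictates
      -- the inverse.
      have hcomm : Commute (u + P : E →L[ℂ] E) (↑u⁻¹ * (1 - P) + ι z⁻¹ * P) := by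
        have c1 : Commute (u + P : E →L[ℂ] E) (↑u⁻¹ : E →L[ℂ] E) :=
          (Commute.refl (u : E →L[ℂ] E)).units_inv_right.add_left huP'.symm
        have c2 : Commute (u + P : E →L[ℂ] E) P := huP.add_left (Commute.refl P)
        exact (c1.mul_right ((Commute.one_right _).sub_right c2)).add_right
          ((show Commute (u + P : E →L[ℂ] E) (ι z⁻¹) from (hzc _).symm).mul_right c2)
      have hinv : (u + P : E →L[ℂ] E) * (↑u⁻¹ * (1 - P) + ι z⁻¹ * P) = 1 := by
        have e1 : (↑u⁻¹ : E →L[ℂ] E) * (1 - P) = (1 - P) * ↑u⁻¹ := by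
          rw [mul_sub, sub_mul, huP'.eq, one_mul, mul_one]
        rw [mul_add, e1, ← mul_assoc, hQ, mul_assoc, ← e1, ← mul_assoc, u.mul_inv, one_mul, hzc,
          ← mul_assoc, hQ2, hzP, mul_assoc, hz', mul_one, sub_add_cancel]
      rw [hzS]
      exact ⟨⟨_, _, hinv, hcomm.eq ▸ hinv⟩, rfl⟩
  have : Nontrivial E := ⟨e, 0, he0⟩
  obtain ⟨r, hr0, hr1, hr⟩ := exists_norm_pow_le_of_spectrum S hSspec
  refine ⟨ξ, r, hr0, hr1, ?_⟩
  filter_upwards [hr, eventually_gt_atTop 0] with n hn hn0 f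
  obtain ⟨m, rfl⟩ := Nat.exists_eq_succ_of_ne_zero hn0.ne'
  have h1 : (T ^ (m + 1)) f - ξ f • e = (S ^ (m + 1)) f := by rw [hSpow]; rfl
  rw [Nat.succ_eq_add_one, h1]
  exact ((S ^ (m + 1)).le_opNorm f).trans (by gcongr)

/-! ## The coordinate function and evaluations -/

lemma neBot_nhdsNE_of_perfect {X : Set ℂ} (hperf : Perfect X) (x : X) : (𝓝[≠] x).NeBot := by
  have h : AccPt (x : ℂ) (𝓟 X) := hperf.acc x x.2
  rw [accPt_principal_iff_nhdsWithin] at h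
  rw [← map_neBot_iff (Subtype.val : X → ℂ), Topology.IsEmbedding.subtypeVal.map_nhdsWithin_eq]
  refine h.mono (nhdsWithin_mono _ ?_)
  rintro y ⟨hy, hne⟩
  exact ⟨⟨y, hy⟩, fun e => hne (congrArg Subtype.val e), rfl⟩

lemma UniformlyRegular.preconnectedSpace {X : Set ℂ} (hreg : UniformlyRegular X)
    (hne : X.Nonempty) : PreconnectedSpace X := by
  have : PathConnectedSpace X :=
    ⟨hne.to_subtype, fun z w => ⟨(hreg.1 z w).choose⟩⟩
  infer_instance

/-- A continuous function on a connected space whose values are roots of a nonzero polynomial is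
constant. -/
lemma eq_of_forall_isRoot {α : Type*} [TopologicalSpace α] [PreconnectedSpace α] {f : α → ℂ}
    (hf : Continuous f) {p : Polynomial ℂ} (hp : p ≠ 0) (hroot : ∀ x, p.IsRoot (f x)) (x y : α) :
    f x = f y := by
  have hfin : (Set.range f).Finite := by
    refine (Polynomial.finite_setOfPred_isRoot hp).subset ?_
    rintro _ ⟨x, rfl⟩
    exact hroot x
  exact hfin.countable.isTotallyDisconnected _ subset_rfl (isPreconnected_range hf) ⟨x, rfl⟩ ⟨y, rfl⟩

namespace DalesDavieAlgebra

open PlaneSet DalesDavie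

variable {X : Set ℂ} [CompactSpace X] {M : WeightSequence}

lemma continuous (f : DalesDavieAlgebra X M) : Continuous f.1 := DiffAt.continuous (f.smooth 0)

/-- The coordinate function as an element of `D(X, M)`. -/
def coord (hperf : Perfect X) : DalesDavieAlgebra X M := by
  have hder : der (fun x : X => (x : ℂ)) = fun _ => 1 := by
    funext x
    rw [der_congr (f := fun x : X => (x : ℂ)) (g := id) (fun _ => rfl) x]
    exact derivWithin_id _ _ (uniqueDiffWithinAt_iff_accPt.2 (hperf.acc x x.2))
  refine ⟨fun x : X => (x : ℂ), ?_, ?_⟩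
  · rintro (_ | n) x
    · exact diffAt_congr (g := id) (fun _ => rfl) x differentiableWithinAt_id
    · rw [Function.iterate_succ_apply, hder]
      exact Smooth.const 1 n x
  · refine summable_of_ne_finset_zero (s := {0, 1}) fun n hn => ?_
    simp only [Finset.mem_insert, Finset.mem_singleton, not_or] at hn
    obtain ⟨m, rfl⟩ := Nat.exists_eq_succ_of_ne_zero hn.1
    rw [term, Function.iterate_succ_apply, hder, iterate_der_const 1 m (by omega)]
    simp [supNorm]

/-- Evaluation at a point. -/
def eval (x : X) : DalesDavieAlgebra X M →ₐ[ℂ] ℂ :=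
  (Pi.evalAlgHom ℂ (fun _ : X => ℂ) x).comp (subalgebra X M).val

lemma sub_apply (f g : DalesDavieAlgebra X M) (x : X) : (f - g) x = f x - g x := rfl

lemma smul_apply (c : ℂ) (f : DalesDavieAlgebra X M) (x : X) : (c • f) x = c * f x := rfl

lemma pow_apply (f : DalesDavieAlgebra X M) (n : ℕ) (x : X) : (f ^ n) x = f x ^ n :=
  map_pow (eval x) f n

lemma term_le_norm (f : DalesDavieAlgebra X M) (n : ℕ) : term M f.1 n ≤ ‖f‖ :=
  f.summable.le_tsum n fun k _ => term_nonneg _ k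

lemma norm_apply_le (f : DalesDavieAlgebra X M) (x : X) : ‖f x‖ ≤ ‖f‖ := by
  have h := f.term_le_norm 0
  rw [term, M.zero, div_one] at h
  exact (le_supNorm f.continuous x).trans h

lemma norm_der_le (f : DalesDavieAlgebra X M) (x : X) : ‖der f.1 x‖ ≤ M.seq 1 * ‖f‖ := by
  have h := f.term_le_norm 1
  rw [term, div_le_iff₀ (M.pos 1), mul_comm] at h
  exact (le_supNorm (DiffAt.continuous (f.smooth 1)) x).trans h

/-! ### Riesz endomorphisms and the iterates of the selfmap -/

namespace IsInducedBy

variable {T : DalesDavieAlgebra X M →A[ℂ] DalesDavieAlgebra X M} {φ : X → X}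

lemma val_eq (hφ : IsInducedBy T φ) (f : DalesDavieAlgebra X M) : (T f).1 = f.1 ∘ φ :=
  funext (hφ f)

lemma smooth (hφ : IsInducedBy T φ) (hperf : Perfect X) : Smooth fun x : X => (φ x : ℂ) := by
  have h := (T (coord hperf)).smooth
  rwa [hφ.val_eq] at h

lemma continuous (hφ : IsInducedBy T φ) (hperf : Perfect X) : Continuous φ :=
  Continuous.subtype_mk (DiffAt.continuous (hφ.smooth hperf 0)) fun x => (φ x).2

lemma pow_apply (hφ : IsInducedBy T φ) (n : ℕ) (f : DalesDavieAlgebra X M) (x : X) :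
    ((T.toContinuousLinearMap ^ n) f) x = f (φ^[n] x) := by
  induction n generalizing x with
  | zero => rfl
  | succ n ih =>
    have h : (T.toContinuousLinearMap ^ (n + 1)) f = T ((T.toContinuousLinearMap ^ n) f) := by
      rw [pow_succ']; rfl
    rw [h, hφ, ih, Function.iterate_succ_apply]

/-- Fixed functions of a Riesz endomorphism are constant. -/
lemma eq_of_fixed [PreconnectedSpace X] (hT : IsRieszOperator T.toContinuousLinearMap)
    {f : DalesDavieAlgebra X M} (hf : T f = f) (x y : X) : f x = f y := by
  -- Fixed functions form a subalgebra, finite-dimensional by the Riesz condition at 1. So f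
  -- satisfies a polynomial equation over ℂ, and its values on the connected set X lie among
  -- finitely many roots.
  let A : Subalgebra ℂ (DalesDavieAlgebra X M) :=
    AlgHom.equalizer (T : DalesDavieAlgebra X M →ₐ[ℂ] DalesDavieAlgebra X M) (AlgHom.id ℂ _)
  have hA : Subalgebra.toSubmodule A = LinearMap.ker ((1 : ℂ) • LinearMap.id -
      (T.toContinuousLinearMap : DalesDavieAlgebra X M →ₗ[ℂ] DalesDavieAlgebra X M)) := by
    ext g
    rw [LinearMap.mem_ker, LinearMap.sub_apply, sub_eq_zero, one_smul]
    exact ⟨fun h => h.symm, fun h => h.symm⟩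
  have hfin : FiniteDimensional ℂ A := by
    have h := hT.finite_ker 1 one_ne_zero
    rw [← hA] at h
    exact h
  have hint : IsIntegral ℂ (⟨f, hf⟩ : A) := IsIntegral.of_finite ℂ _
  obtain ⟨p, hp, hpf⟩ := hint
  refine eq_of_forall_isRoot f.continuous hp.ne_zero (fun x => ?_) x y
  have h := congrArg ((eval x).comp A.val) hpf
  rw [map_zero, ← Polynomial.aeval_def, ← Polynomial.aeval_algHom_apply] at h
  rw [Polynomial.IsRoot, ← Polynomial.coe_aeval_eq_eval]
  exact h

/-- The only unimodular or larger spectral value is `1`. -/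
lemma eq_one_of_mem_spectrum [PreconnectedSpace X] (hφ : IsInducedBy T φ)
    (hT : IsRieszOperator T.toContinuousLinearMap) {z : ℂ}
    (hz : z ∈ spectrum ℂ T.toContinuousLinearMap) (hz1 : 1 ≤ ‖z‖) : z = 1 := by
  have hz0 : z ≠ 0 := by rintro rfl; simp at hz1; linarith
  obtain ⟨f, hf0, hf⟩ := hT.eigenvalue z hz hz0
  change T f = z • f at hf
  obtain ⟨x, hx⟩ : ∃ x, f x ≠ 0 := by
    by_contra! h
    exact hf0 (ext h)
  have heig : ∀ x, f (φ x) = z * f x := fun x => by rw [← hφ, hf, smul_apply]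
  -- The values z^n f(x) of f along an orbit stay bounded.
  have hnorm : ‖z‖ = 1 := by
    refine le_antisymm (le_of_not_gt fun hgt => ?_) hz1
    have hiter : ∀ n, f (φ^[n] x) = z ^ n * f x := by
      intro n
      induction n with
      | zero => simp
      | succ n ih => rw [Function.iterate_succ_apply', heig, ih]; ring
    have hx' : 0 < ‖f x‖ := norm_pos_iff.2 hx
    obtain ⟨n, hn⟩ := pow_unbounded_of_one_lt (‖f‖ / ‖f x‖) hgt
    rw [div_lt_iff₀ hx'] at hn
    have h := f.norm_apply_le (φ^[n] x)
    rw [hiter, norm_mul, norm_pow] at h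
    exact absurd hn (not_lt.2 h)
  -- As T is multiplicative, f^n is an eigenvector for z^n, nonzero at x. Only finitely many
  -- spectral values lie on the unit circle, so z is a root of unity.
  have hpow : ∀ n, z ^ n ∈ spectrum ℂ T.toContinuousLinearMap := by
    intro n hu
    rw [spectrum.mem_resolventSet_iff] at hu
    obtain ⟨u, hu⟩ := hu
    have h1 : (u : DalesDavieAlgebra X M →L[ℂ] DalesDavieAlgebra X M) (f ^ n) = 0 := by
      rw [hu, Algebra.algebraMap_eq_smul_one]
      change z ^ n • f ^ n - T (f ^ n) = 0
      rw [map_pow, hf, smul_pow, sub_self]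
    have h2 : f ^ n = 0 := by
      have h3 := congrArg (fun B : DalesDavieAlgebra X M →L[ℂ] DalesDavieAlgebra X M => B (f ^ n))
        u.inv_mul
      change (↑u⁻¹ : DalesDavieAlgebra X M →L[ℂ] DalesDavieAlgebra X M) (u.1 (f ^ n)) = f ^ n at h3
      rw [← h3]
      change (↑u⁻¹ : DalesDavieAlgebra X M →L[ℂ] DalesDavieAlgebra X M)
        ((u : DalesDavieAlgebra X M →L[ℂ] DalesDavieAlgebra X M) (f ^ n)) = 0
      rw [h1, map_zero]
    have h4 := DalesDavieAlgebra.pow_apply f n x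
    rw [h2] at h4
    exact pow_ne_zero n hx h4.symm
  obtain ⟨r, hr, hzr⟩ : ∃ r : ℕ, r ≠ 0 ∧ z ^ r = 1 := by
    have hfin := hT.discrete 1 one_pos
    have hnot : ¬ Function.Injective fun n : ℕ => z ^ n := by
      intro hinj
      refine Set.infinite_range_of_injective hinj (hfin.subset ?_)
      rintro _ ⟨n, rfl⟩
      exact ⟨hpow n, by simp [hnorm]⟩
    obtain ⟨i, j, hij, hne⟩ : ∃ i j : ℕ, z ^ i = z ^ j ∧ i < j := by
      simp only [Function.Injective, not_forall] at hnot
      obtain ⟨i, j, hij, hne⟩ := hnot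
      rcases lt_or_gt_of_ne hne with h | h
      · exact ⟨i, j, hij, h⟩
      · exact ⟨j, i, hij.symm, h⟩
    refine ⟨j - i, by omega, ?_⟩
    have h1 : z ^ i * z ^ (j - i) = z ^ i * 1 := by
      rw [← pow_add, mul_one, hij]; congr 1; omega
    exact mul_left_cancel₀ (pow_ne_zero i hz0) h1
  have hfr : T (f ^ r) = f ^ r := by rw [map_pow, hf, smul_pow, hzr, one_smul]
  -- The fixed function f^r is constant, so f takes values among the r-th roots of one number.
  have hconst : ∀ y, f y = f x := by
    intro y
    refine eq_of_forall_isRoot (p := Polynomial.X ^ r - Polynomial.C (f x ^ r)) f.continuous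
      (Polynomial.X_pow_sub_C_ne_zero (Nat.pos_of_ne_zero hr) _) (fun w => ?_) y x
    have h1 := eq_of_fixed hT hfr w x
    rw [DalesDavieAlgebra.pow_apply, DalesDavieAlgebra.pow_apply] at h1
    simp [Polynomial.IsRoot, h1]
  have h5 := heig x
  rw [hconst] at h5
  exact (mul_right_cancel₀ hx (by rw [one_mul, ← h5])).symm

/-- The powers of a Riesz endomorphism converge geometrically to a rank one projection. -/
lemma exists_geometric_convergence [PreconnectedSpace X] [Nonempty X] (hφ : IsInducedBy T φ)
    (hT : IsRieszOperator T.toContinuousLinearMap) :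
    ∃ (ξ : StrongDual ℂ (DalesDavieAlgebra X M)) (r : ℝ), 0 < r ∧ r < 1 ∧ ∀ᶠ n : ℕ in atTop,
      ∀ f, ‖(T.toContinuousLinearMap ^ n) f - ξ f • (1 : DalesDavieAlgebra X M)‖ ≤ r ^ n * ‖f‖ := by
  obtain ⟨x⟩ := ‹Nonempty X›
  refine hT.exists_geometric_convergence (fun h => ?_) (map_one T)
    (fun z hz hz1 => hφ.eq_one_of_mem_spectrum hT hz hz1) (fun f hf => ⟨f x, ?_⟩) (fun f hf => ?_)
  · have h1 := congrArg (eval x) h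
    rw [map_one, map_zero] at h1
    exact one_ne_zero h1
  · ext y
    rw [smul_apply, eq_of_fixed hT hf y x]
    exact (mul_one _).symm
  -- If f - f ∘ φ = 1, then f drops by 1 at each step of an orbit, although it is bounded.
  · have h1 : ∀ y, f (φ y) = f y - 1 := by
      intro y
      have h2 : f y - f (φ y) = 1 := by
        rw [← hφ]
        exact congrArg (eval y) hf
      rw [← h2]
      ring
    have h2 : ∀ n : ℕ, f (φ^[n] x) = f x - n := by
      intro n
      induction n with
      | zero => simp
      | succ n ih => rw [Function.iterate_succ_apply', h1, ih]; push_cast; ring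
    obtain ⟨n, hn⟩ := exists_nat_gt (‖f‖ + ‖f‖)
    have h3 : (n : ℂ) = f x - f (φ^[n] x) := by rw [h2]; ring
    have h4 : (n : ℝ) ≤ ‖f‖ + ‖f‖ := by
      rw [← Complex.norm_natCast, h3]
      exact (norm_sub_le _ _).trans (add_le_add (f.norm_apply_le _) (f.norm_apply_le _))
    linarith

/-- The selfmap of `X` has exactly one fixed point. -/
lemma existsUnique_fixed [PreconnectedSpace X] [Nonempty X] (hφ : IsInducedBy T φ)
    (hperf : Perfect X) (hT : IsRieszOperator T.toContinuousLinearMap) : ∃! x, φ x = x := by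
  obtain ⟨ξ, r, hr0, hr1, hev⟩ := hφ.exists_geometric_convergence hT
  set f : DalesDavieAlgebra X M := coord hperf
  -- For the coordinate function, T^n f is the n-th iterate of φ, so all orbits have the same limit.
  have hlim : ∀ x, Tendsto (fun n => ((φ^[n] x : X) : ℂ)) atTop (𝓝 (ξ f)) := by
    intro x
    rw [tendsto_iff_norm_sub_tendsto_zero]
    have h0 : Tendsto (fun n : ℕ => r ^ n * ‖f‖) atTop (𝓝 0) := by
      simpa using (tendsto_pow_atTop_nhds_zero_of_lt_one hr0.le hr1).mul_const ‖f‖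
    refine squeeze_zero' (Eventually.of_forall fun _ => norm_nonneg _) ?_ h0
    filter_upwards [hev] with n hn
    refine le_trans ?_ (hn f)
    refine le_trans (le_of_eq ?_) (norm_apply_le _ x)
    rw [sub_apply, hφ.pow_apply, smul_apply]
    congr 2
    exact (mul_one _).symm
  obtain ⟨x⟩ := ‹Nonempty X›
  have hmem : ξ f ∈ X := hperf.closed.mem_of_tendsto (hlim x) (Eventually.of_forall fun n => (φ^[n] x).2)
  have hlim' : ∀ y, Tendsto (fun n => φ^[n] y) atTop (𝓝 (⟨ξ f, hmem⟩ : X)) := fun y =>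
    tendsto_subtype_rng.2 (hlim y)
  refine ⟨⟨ξ f, hmem⟩, ?_, fun y hy => ?_⟩
  · have h1 := ((hφ.continuous hperf).tendsto _).comp (hlim' x)
    have h2 := (hlim' x).comp (tendsto_add_atTop_nat 1)
    refine tendsto_nhds_unique h1 (h2.congr fun n => ?_)
    exact Function.iterate_succ_apply' φ n x
  · refine tendsto_nhds_unique ?_ (hlim' y)
    simp only [Function.iterate_fixed hy]
    exact tendsto_const_nhds

/-- The powers of a Riesz endomorphism converge geometrically to the evaluation at the fixed
point. -/
lemma exists_geometric_convergence_eval [PreconnectedSpace X] (hφ : IsInducedBy T φ)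
    (hT : IsRieszOperator T.toContinuousLinearMap) {x₀ : X} (hx₀ : φ x₀ = x₀) :
    ∃ r : ℝ, 0 < r ∧ r < 1 ∧ ∀ᶠ n : ℕ in atTop, ∀ f : DalesDavieAlgebra X M,
      f x₀ = 0 → ‖(T.toContinuousLinearMap ^ n) f‖ ≤ r ^ n * ‖f‖ := by
  have : Nonempty X := ⟨x₀⟩
  obtain ⟨ξ, r, hr0, hr1, hev⟩ := hφ.exists_geometric_convergence hT
  refine ⟨r, hr0, hr1, ?_⟩
  -- The value of T^n f at x₀ is f(x₀) for every n, and it tends to ξ(f).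
  have hξ : ∀ f : DalesDavieAlgebra X M, f x₀ = 0 → ξ f = 0 := by
    intro f hf
    have h0 : Tendsto (fun n : ℕ => r ^ n * ‖f‖) atTop (𝓝 0) := by
      simpa using (tendsto_pow_atTop_nhds_zero_of_lt_one hr0.le hr1).mul_const ‖f‖
    rw [← norm_le_zero_iff]
    refine ge_of_tendsto h0 ?_
    filter_upwards [hev] with n hn
    refine le_trans ?_ (hn f)
    refine le_trans (le_of_eq ?_) (norm_apply_le _ x₀)
    rw [sub_apply, hφ.pow_apply, smul_apply, Function.iterate_fixed hx₀, hf, zero_sub, norm_neg]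
    congr 1
    exact (mul_one _).symm
  filter_upwards [hev] with n hn f hf
  have h := hn f
  rwa [hξ f hf, zero_smul, sub_zero] at h

end IsInducedBy

end DalesDavieAlgebra

/-! ## Leading terms of eigenvectors -/

namespace DalesDavieAlgebra.IsInducedBy

open PlaneSet DalesDavie

variable {X : Set ℂ} [CompactSpace X] {M : WeightSequence}
  {T : DalesDavieAlgebra X M →A[ℂ] DalesDavieAlgebra X M} {φ : X → X} {x₀ : X}

lemma hasLeadingTerm (hφ : IsInducedBy T φ) (hperf : Perfect X) (hx₀ : φ x₀ = x₀) {k : ℕ} {c : ℂ}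
    {f : DalesDavieAlgebra X M} (hf : HasLeadingTerm x₀ k f.1 c) :
    HasLeadingTerm x₀ k (T f).1 (der (fun x : X => (φ x : ℂ)) x₀ ^ k * c) := by
  rw [hφ.val_eq]
  refine hf.comp hx₀ (hφ.continuous hperf) ?_
  have h := HasLeadingTerm.of_diffAt (hφ.smooth hperf 0 x₀)
  simpa only [Function.iterate_zero, id_eq, hx₀] using h

/-- The operator T - z acts diagonally on leading terms: it preserves the order unless a^k = z, and
it preserves flatness. -/
lemma hasLeadingTerm_sub (hφ : IsInducedBy T φ) (hperf : Perfect X) (hx₀ : φ x₀ = x₀) {k : ℕ}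
    {c : ℂ} (z : ℂ) {f : DalesDavieAlgebra X M} (hf : HasLeadingTerm x₀ k f.1 c) :
    HasLeadingTerm x₀ k (T f - z • f).1 ((der (fun x : X => (φ x : ℂ)) x₀ ^ k - z) * c) := by
  have h := (hφ.hasLeadingTerm hperf hx₀ hf).add (hf.const_mul (-z))
  convert h using 1
  · funext x
    change T f x - z * f x = T f x + -z * f x
    ring
  · ring

lemma hasLeadingTerm_coord_sub (hperf : Perfect X) (x₀ : X) :
    HasLeadingTerm x₀ 1
      (coord hperf - algebraMap ℂ (DalesDavieAlgebra X M) (x₀ : ℂ)).1 1 := by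
  have h : (fun w : X => (coord hperf - algebraMap ℂ (DalesDavieAlgebra X M) (x₀ : ℂ)).1 w -
      1 * ((w : ℂ) - x₀) ^ 1) = fun _ => 0 := by
    funext w
    change (w : ℂ) - x₀ - 1 * ((w : ℂ) - x₀) ^ 1 = 0
    ring
  change (fun w : X => (coord hperf - algebraMap ℂ (DalesDavieAlgebra X M) (x₀ : ℂ)).1 w -
      1 * ((w : ℂ) - x₀) ^ 1) =o[𝓝 x₀] _
  rw [h]
  exact Asymptotics.isLittleO_zero _ _

/-- The function T^n(w - x₀) has derivative a^n at x₀. Its norm tends to 0, and point derivatives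
are bounded by `M.seq 1` times the norm. -/
lemma norm_der_lt_one [PreconnectedSpace X] (hφ : IsInducedBy T φ) (hperf : Perfect X)
    (hT : IsRieszOperator T.toContinuousLinearMap) (hx₀ : φ x₀ = x₀) :
    ‖der (fun x : X => (φ x : ℂ)) x₀‖ < 1 := by
  set a := der (fun x : X => (φ x : ℂ)) x₀ with ha
  obtain ⟨r, hr0, hr1, hev⟩ := hφ.exists_geometric_convergence_eval hT hx₀
  set f : DalesDavieAlgebra X M := coord hperf - algebraMap ℂ _ (x₀ : ℂ)
  have hf0 : f x₀ = 0 := sub_self (x₀ : ℂ)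
  have hlead : ∀ n, HasLeadingTerm x₀ 1 ((T.toContinuousLinearMap ^ n) f).1 (a ^ n) := by
    intro n
    induction n with
    | zero => simpa using hasLeadingTerm_coord_sub (M := M) hperf x₀
    | succ n ih =>
      have h := hφ.hasLeadingTerm hperf hx₀ ih
      rw [← ha, pow_one, ← pow_succ'] at h
      rw [pow_succ' T.toContinuousLinearMap]
      exact h
  have hder : ∀ n, der ((T.toContinuousLinearMap ^ n) f).1 x₀ = a ^ n := by
    intro n
    have h0 : ((T.toContinuousLinearMap ^ n) f).1 x₀ = 0 := by
      have := hφ.pow_apply n f x₀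
      rw [Function.iterate_fixed hx₀, hf0] at this
      exact this
    have h1 := hlead n
    have h2 : HasLeadingTerm x₀ 1 (fun w => ((T.toContinuousLinearMap ^ n) f).1 w -
        ((T.toContinuousLinearMap ^ n) f).1 x₀) (a ^ n) := by
      simpa only [h0, sub_zero] using h1
    exact h2.hasDerivWithinAt.derivWithin (uniqueDiffWithinAt_iff_accPt.2 (hperf.acc _ x₀.2))
  have hlim : Tendsto (fun n : ℕ => M.seq 1 * (r ^ n * ‖f‖)) atTop (𝓝 0) := by
    simpa using ((tendsto_pow_atTop_nhds_zero_of_lt_one hr0.le hr1).mul_const ‖f‖).const_mul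
      (M.seq 1)
  obtain ⟨n, hn, hn1⟩ := (hev.and (hlim.eventually (gt_mem_nhds one_pos))).exists
  have h3 := norm_der_le ((T.toContinuousLinearMap ^ n) f) x₀
  rw [hder, norm_pow] at h3
  have h4 : ‖a‖ ^ n < 1 :=
    h3.trans_lt ((mul_le_mul_of_nonneg_left (hn f hf0) (M.pos 1).le).trans_lt hn1)
  by_contra! h
  exact absurd (one_le_pow₀ h) (not_le.2 h4)

/-- Flat eigenvectors with nonzero eigenvalue vanish. -/
lemma eq_zero_of_flat [PreconnectedSpace X] (hφ : IsInducedBy T φ) (hperf : Perfect X)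
    (hT : IsRieszOperator T.toContinuousLinearMap) (hx₀ : φ x₀ = x₀) {z : ℂ} (hz : z ≠ 0)
    {f : DalesDavieAlgebra X M} (hf : T f = z • f) (hflat : ∀ k, HasLeadingTerm x₀ k f.1 0) :
    f = 0 := by
  obtain ⟨r, hr0, hr1, hev⟩ := hφ.exists_geometric_convergence_eval hT hx₀
  set g : DalesDavieAlgebra X M := coord hperf - algebraMap ℂ _ (x₀ : ℂ)
  have hg0 : g x₀ = 0 := sub_self (x₀ : ℂ)
  have hz' : 0 < ‖z‖ := norm_pos_iff.2 hz
  -- Orbits approach x₀ like r^n, so flatness bounds f(φ^n(x)) = z^n f(x) by a multiple of r^(Nn).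
  -- With r^N < |z| this forces f(x) = 0.
  obtain ⟨N, hN⟩ := exists_pow_lt_of_lt_one hz' hr1
  ext x
  have hdist : ∀ᶠ n : ℕ in atTop, ‖((φ^[n] x : X) : ℂ) - x₀‖ ≤ r ^ n * ‖g‖ := by
    filter_upwards [hev] with n hn
    have h1 := ((T.toContinuousLinearMap ^ n) g).norm_apply_le x
    rw [hφ.pow_apply] at h1
    exact h1.trans (hn g hg0)
  have hlim : Tendsto (fun n => φ^[n] x) atTop (𝓝 x₀) := by
    refine tendsto_subtype_rng.2 (tendsto_iff_norm_sub_tendsto_zero.2 ?_)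
    refine squeeze_zero' (Eventually.of_forall fun _ => norm_nonneg _) hdist ?_
    simpa using (tendsto_pow_atTop_nhds_zero_of_lt_one hr0.le hr1).mul_const ‖g‖
  have hiter : ∀ n, f (φ^[n] x) = z ^ n * f x := by
    intro n
    induction n with
    | zero => simp
    | succ n ih => rw [Function.iterate_succ_apply', ← hφ, hf, smul_apply, ih]; ring
  have hbound : ∀ᶠ n : ℕ in atTop, ‖f x‖ ≤ (r ^ N / ‖z‖) ^ n * ‖g‖ ^ N := by
    have h1 := (show _ =o[𝓝 x₀] _ from hflat N).def one_pos
    filter_upwards [hdist, hlim.eventually h1] with n hn h2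
    rw [zero_mul, sub_zero, one_mul, norm_pow] at h2
    have h3 : ‖f (φ^[n] x)‖ ≤ (r ^ n * ‖g‖) ^ N := h2.trans (by gcongr)
    rw [hiter, norm_mul, norm_pow] at h3
    rw [div_pow, div_mul_eq_mul_div, le_div_iff₀ (by positivity), mul_comm]
    refine h3.trans (le_of_eq ?_)
    rw [mul_pow, ← pow_mul, ← pow_mul, mul_comm n N]
  have h0 : Tendsto (fun n : ℕ => (r ^ N / ‖z‖) ^ n * ‖g‖ ^ N) atTop (𝓝 0) := by
    simpa using (tendsto_pow_atTop_nhds_zero_of_lt_one (by positivity)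
      ((div_lt_one hz').2 hN)).mul_const (‖g‖ ^ N)
  exact norm_le_zero_iff.1 (ge_of_tendsto h0 hbound)

/-- The endomorphism as a linear map. -/
abbrev linEnd (T : DalesDavieAlgebra X M →A[ℂ] DalesDavieAlgebra X M) :
    Module.End ℂ (DalesDavieAlgebra X M) :=
  (T.toContinuousLinearMap : DalesDavieAlgebra X M →ₗ[ℂ] DalesDavieAlgebra X M)

lemma pow_succ_sub_apply (T : DalesDavieAlgebra X M →A[ℂ] DalesDavieAlgebra X M) (z : ℂ) (n : ℕ)
    (f : DalesDavieAlgebra X M) :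
    ((linEnd T - z • 1) ^ (n + 1)) f = ((linEnd T - z • 1) ^ n) (T f - z • f) := by
  rw [pow_succ]
  rfl

/-- Nonzero generalized eigenvectors with nonzero eigenvalue have a nonzero leading term, and its
order determines the eigenvalue. -/
lemma exists_leadingTerm [PreconnectedSpace X] (hφ : IsInducedBy T φ) (hperf : Perfect X)
    (hreg : UniformlyRegular X) (hT : IsRieszOperator T.toContinuousLinearMap) (hx₀ : φ x₀ = x₀)
    {z : ℂ} (hz : z ≠ 0) {f : DalesDavieAlgebra X M} (hf0 : f ≠ 0)
    (hf : f ∈ Module.End.maxGenEigenspace (linEnd T) z) :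
    ∃ m c, c ≠ 0 ∧ HasLeadingTerm x₀ m f.1 c ∧ der (fun x : X => (φ x : ℂ)) x₀ ^ m = z := by
  have := neBot_nhdsNE_of_perfect hperf x₀
  obtain ⟨n, hn⟩ := (Module.End.mem_maxGenEigenspace _ _ _).1 hf
  clear hf
  rcases exists_leadingTerm_or_flat hreg x₀ f.smooth with ⟨m, c, hc, hlead⟩ | hflat
  · refine ⟨m, c, hc, hlead, ?_⟩
    by_contra hne
    -- If a^m ≠ z, each application of T - z multiplies the leading coefficient by a nonzero number,
    -- so no power of it kills g.
    have key : ∀ n (g : DalesDavieAlgebra X M) d, d ≠ 0 → HasLeadingTerm x₀ m g.1 d →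
        ((linEnd T - z • 1) ^ n : Module.End ℂ (DalesDavieAlgebra X M)) g ≠ 0 := by
      intro n
      induction n with
      | zero =>
        intro g d hd hg h0
        rw [pow_zero] at h0
        change g = 0 at h0
        rw [h0] at hg
        have h1 : HasLeadingTerm x₀ m (0 : DalesDavieAlgebra X M).1 0 := by
          rw [zero_val]
          simp [HasLeadingTerm]
        exact hd (hg.unique h1)
      | succ n ih =>
        intro g d hd hg
        rw [pow_succ_sub_apply]
        exact ih _ _ (mul_ne_zero (sub_ne_zero.2 hne) hd) (hφ.hasLeadingTerm_sub hperf hx₀ z hg)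
    exact key n f c hc hlead hn
  · exfalso
    -- The last nonzero vector f, (T - z)f, ... is a flat eigenvector, hence zero after all.
    induction n generalizing f with
    | zero => exact hf0 hn
    | succ n ih =>
      rw [pow_succ_sub_apply] at hn
      by_cases h0 : T f - z • f = 0
      · exact hf0 (hφ.eq_zero_of_flat hperf hT hx₀ hz (sub_eq_zero.1 h0) hflat)
      · refine ih h0 hn fun k => ?_
        simpa using hφ.hasLeadingTerm_sub hperf hx₀ z (hflat k)

lemma pow_injective_of_norm_lt_one {a : ℂ} (ha1 : ‖a‖ < 1) {m k : ℕ} (h : a ^ m = a ^ k)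
    (h0 : a ^ k ≠ 0) : m = k := by
  rcases eq_or_ne a 0 with rfl | ha
  · by_contra hmk
    rcases Nat.eq_zero_or_pos k with rfl | hk
    · rw [zero_pow hmk, pow_zero] at h
      exact zero_ne_one h
    · exact h0 (zero_pow hk.ne')
  · have h1 := congrArg norm h
    rw [norm_pow, norm_pow] at h1
    exact (pow_right_strictAnti₀ (norm_pos_iff.2 ha) ha1).injective h1

/-- Generalized eigenspaces at nonzero eigenvalues are one-dimensional. -/
lemma finrank_maxGenEigenspace [PreconnectedSpace X] (hφ : IsInducedBy T φ) (hperf : Perfect X)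
    (hreg : UniformlyRegular X) (hT : IsRieszOperator T.toContinuousLinearMap) (hx₀ : φ x₀ = x₀)
    {z : ℂ} (hz : z ≠ 0) {f : DalesDavieAlgebra X M} (hf0 : f ≠ 0)
    {V : Submodule ℂ (DalesDavieAlgebra X M)} (hfV : f ∈ V)
    (hV : V ≤ Module.End.maxGenEigenspace (linEnd T) z) : Module.finrank ℂ V = 1 := by
  have := neBot_nhdsNE_of_perfect hperf x₀
  have ha1 := hφ.norm_der_lt_one hperf hT hx₀
  rw [finrank_eq_one_iff_of_nonzero' (⟨f, hfV⟩ : V) (by simpa [Subtype.ext_iff] using hf0)]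
  rintro ⟨g, hg⟩
  obtain ⟨m, c, hc, hlead, hm⟩ := hφ.exists_leadingTerm hperf hreg hT hx₀ hz hf0 (hV hfV)
  by_cases hg0 : g = 0
  · exact ⟨0, Subtype.ext (by simp [hg0])⟩
  obtain ⟨k, d, -, hgl, hk⟩ := hφ.exists_leadingTerm hperf hreg hT hx₀ hz hg0 (hV hg)
  obtain rfl : k = m := pow_injective_of_norm_lt_one ha1 (hk.trans hm.symm) (by rwa [hm])
  refine ⟨d / c, Subtype.ext ?_⟩
  change (d / c) • f = g
  -- The nonzero difference would again have order m, the only exponent with a^m = z, but the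
  -- coefficients at that order cancel.
  by_contra hne
  have hdiff : (d / c) • f - g ≠ 0 := sub_ne_zero.2 hne
  obtain ⟨j, b, hb, hl, hj⟩ := hφ.exists_leadingTerm hperf hreg hT hx₀ hz hdiff
    (hV (V.sub_mem (V.smul_mem _ hfV) hg))
  obtain rfl : j = k := pow_injective_of_norm_lt_one ha1 (hj.trans hm.symm) (by rwa [hm])
  have h1 := (hlead.const_mul (d / c)).add (hgl.const_mul (-1))
  refine hb ((hl.unique (d := d / c * c + -1 * d) ?_).trans (by field_simp; ring))
  convert h1 using 1
  funext x
  change d / c * f x - g x = d / c * f x + -1 * g x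
  ring

/-- Otherwise a^k f - Tf = (w - x₀)^k for some f. If f has order m < k, so does the left side; if f
has order at least k or is flat, the left side has no term of order k. The hypothesis is void for k
= 0 and still holds for a = 0, k = 1. -/
lemma pow_der_mem_spectrum_of_ne (hφ : IsInducedBy T φ) (hperf : Perfect X)
    (hreg : UniformlyRegular X) (hx₀ : φ x₀ = x₀) {k : ℕ}
    (hk : ∀ m < k, der (fun x : X => (φ x : ℂ)) x₀ ^ m ≠ der (fun x : X => (φ x : ℂ)) x₀ ^ k) :
    der (fun x : X => (φ x : ℂ)) x₀ ^ k ∈ spectrum ℂ T.toContinuousLinearMap := by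
  have := neBot_nhdsNE_of_perfect hperf x₀
  set a := der (fun x : X => (φ x : ℂ)) x₀ with ha
  intro hu
  rw [spectrum.mem_resolventSet_iff] at hu
  obtain ⟨u, hu⟩ := hu
  set g : DalesDavieAlgebra X M := (coord hperf - algebraMap ℂ _ (x₀ : ℂ)) ^ k with hg
  have hglead : HasLeadingTerm x₀ k g.1 1 := by
    have h := (hasLeadingTerm_coord_sub (M := M) hperf x₀).pow k
    rw [one_mul, one_pow] at h
    exact h
  set f : DalesDavieAlgebra X M :=
    (↑u⁻¹ : DalesDavieAlgebra X M →L[ℂ] DalesDavieAlgebra X M) g with hf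
  have hfg : T f - a ^ k • f = (-1 : ℂ) • g := by
    have h1 : (u : DalesDavieAlgebra X M →L[ℂ] DalesDavieAlgebra X M) f = g :=
      congrArg (fun B : DalesDavieAlgebra X M →L[ℂ] DalesDavieAlgebra X M => B g) u.mul_inv
    rw [hu, Algebra.algebraMap_eq_smul_one] at h1
    change a ^ k • f - T f = g at h1
    rw [← h1, neg_one_smul, neg_sub]
  have hlead : HasLeadingTerm x₀ k (T f - a ^ k • f).1 (-1 * 1) := by
    rw [hfg]
    exact hglead.const_mul (-1)
  have hne : (-1 * 1 : ℂ) ≠ 0 := by norm_num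
  rcases exists_leadingTerm_or_flat hreg x₀ f.smooth with ⟨m, c, hc, hfl⟩ | hflat
  · have h1 := hφ.hasLeadingTerm_sub hperf hx₀ (a ^ k) hfl
    rcases lt_trichotomy m k with h | rfl | h
    · exact h.ne (h1.order_unique (mul_ne_zero (sub_ne_zero.2 (hk m h)) hc) hlead hne)
    · exact hne (hlead.unique (by simpa [← ha] using h1))
    · exact hne (hlead.unique (h1.zero_of_lt h))
  · have h1 := hφ.hasLeadingTerm_sub hperf hx₀ (a ^ k) (hflat k)
    exact hne (hlead.unique (by simpa using h1))

/-- The powers of the derivative at the fixed point belong to the spectrum. -/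
lemma pow_der_mem_spectrum [PreconnectedSpace X] (hφ : IsInducedBy T φ) (hperf : Perfect X)
    (hreg : UniformlyRegular X) (hT : IsRieszOperator T.toContinuousLinearMap) (hx₀ : φ x₀ = x₀)
    {k : ℕ} (hk : k ≠ 0) :
    der (fun x : X => (φ x : ℂ)) x₀ ^ k ∈ spectrum ℂ T.toContinuousLinearMap := by
  have ha1 := hφ.norm_der_lt_one hperf hT hx₀
  -- For a = 0 all positive powers coincide, and exponent 1 suffices.
  by_cases h0 : der (fun x : X => (φ x : ℂ)) x₀ = 0
  · have h1 := hφ.pow_der_mem_spectrum_of_ne hperf hreg hx₀ (k := 1) fun m hm => by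
      obtain rfl : m = 0 := by omega
      simp [h0]
    rw [h0, pow_one] at h1
    rwa [h0, zero_pow hk]
  · exact hφ.pow_der_mem_spectrum_of_ne hperf hreg hx₀ fun m hm h =>
      hm.ne (pow_injective_of_norm_lt_one ha1 h (pow_ne_zero k h0))

/-- A Riesz endomorphism is not invertible. -/
lemma zero_mem_spectrum [PreconnectedSpace X] (hφ : IsInducedBy T φ) (hperf : Perfect X)
    (hreg : UniformlyRegular X) (hT : IsRieszOperator T.toContinuousLinearMap)
    (hx₀ : φ x₀ = x₀) : (0 : ℂ) ∈ spectrum ℂ T.toContinuousLinearMap := by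
  have ha1 := hφ.norm_der_lt_one hperf hT hx₀
  have hmem := fun k (hk : k ≠ 0) => hφ.pow_der_mem_spectrum hperf hreg hT hx₀ hk
  set a := der (fun x : X => (φ x : ℂ)) x₀ with ha
  by_cases h0 : a = 0
  · simpa [h0] using hmem 1 one_ne_zero
  -- A bounded inverse is impossible, since T shrinks eigenvectors by the arbitrarily small factors
  -- |a|^n.
  intro hu
  rw [spectrum.mem_resolventSet_iff] at hu
  obtain ⟨u, hu⟩ := hu
  set U : DalesDavieAlgebra X M →L[ℂ] DalesDavieAlgebra X M := ↑u⁻¹ with hU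
  have hlim : Tendsto (fun n : ℕ => ‖U‖ * ‖a‖ ^ n) atTop (𝓝 0) := by
    simpa using (tendsto_pow_atTop_nhds_zero_of_lt_one (norm_nonneg a) ha1).const_mul ‖U‖
  obtain ⟨n, hn, hn0⟩ := ((hlim.eventually (gt_mem_nhds one_pos)).and (eventually_ne_atTop 0)).exists
  obtain ⟨f, hf0, hf⟩ := hT.eigenvalue _ (hmem n hn0) (pow_ne_zero n h0)
  have h1 : U ((u : DalesDavieAlgebra X M →L[ℂ] DalesDavieAlgebra X M) f) = f :=
    congrArg (fun B : DalesDavieAlgebra X M →L[ℂ] DalesDavieAlgebra X M => B f) u.inv_mul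
  have h2 : (u : DalesDavieAlgebra X M →L[ℂ] DalesDavieAlgebra X M) f = -(a ^ n • f) := by
    rw [hu, map_zero, zero_sub, ← hf]
    rfl
  rw [h2] at h1
  have h3 := U.le_opNorm (-(a ^ n • f))
  rw [h1, norm_neg, norm_smul, norm_pow, ← mul_assoc] at h3
  have h4 : 0 < ‖f‖ := norm_pos_iff.2 hf0
  nlinarith

end DalesDavieAlgebra.IsInducedBy

end

theorem theorem2p4 (X : Set ℂ) [CompactSpace X] (hne : X.Nonempty) (hperf : Perfect X)
    (hreg : UniformlyRegular X) (M : WeightSequence) (hM : M.Nonanalytic)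
    (T : DalesDavieAlgebra X M →A[ℂ] DalesDavieAlgebra X M)
    (hT : IsRieszOperator T.toContinuousLinearMap)
    (φ : X → X) (hφ : DalesDavieAlgebra.IsInducedBy T φ) :
    (∃! x : X, φ x = x) ∧
    ∀ x₀ : X, φ x₀ = x₀ →
      PlaneSet.DiffAt (fun x : X => (φ x : ℂ)) x₀ ∧
      spectrum ℂ T.toContinuousLinearMap =
        {z : ℂ | ∃ n : ℕ, 1 ≤ n ∧ z = PlaneSet.der (fun x : X => (φ x : ℂ)) x₀ ^ n} ∪ {0, 1} ∧
      ∀ z ∈ spectrum ℂ T.toContinuousLinearMap, z ≠ 0 →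
        Module.finrank ℂ (Module.End.eigenspace
          (T.toContinuousLinearMap : DalesDavieAlgebra X M →ₗ[ℂ] DalesDavieAlgebra X M) z) = 1 ∧
        Module.finrank ℂ (Module.End.maxGenEigenspace
          (T.toContinuousLinearMap : DalesDavieAlgebra X M →ₗ[ℂ] DalesDavieAlgebra X M) z) = 1 := by
  have := hreg.preconnectedSpace hne
  have : Nonempty X := hne.to_subtype
  refine ⟨hφ.existsUnique_fixed hperf hT, fun x₀ hx₀ => ⟨hφ.smooth hperf 0 x₀, ?_, ?_⟩⟩
  · refine Set.Subset.antisymm (fun z hz => ?_) ?_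
    · by_cases hz0 : z = 0
      · exact Or.inr (Or.inl hz0)
      obtain ⟨f, hf0, hf⟩ := hT.eigenvalue z hz hz0
      obtain ⟨m, -, -, -, hm⟩ := hφ.exists_leadingTerm hperf hreg hT hx₀ hz0 hf0
        ((Module.End.genEigenspace _ z).monotone le_top (Module.End.mem_eigenspace_iff.2 hf))
      -- Order 0 accounts for the eigenvalue 1, which is listed apart from the positive powers.
      rcases Nat.eq_zero_or_pos m with rfl | hpos
      · exact Or.inr (Or.inr (by rw [← hm, pow_zero]; rfl))
      · exact Or.inl ⟨m, hpos, hm.symm⟩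
    · rintro z (⟨n, hn, rfl⟩ | rfl | rfl)
      · exact hφ.pow_der_mem_spectrum hperf hreg hT hx₀ (by omega)
      · exact hφ.zero_mem_spectrum hperf hreg hT hx₀
      · simpa using hφ.pow_der_mem_spectrum_of_ne hperf hreg hx₀ (k := 0) (by simp)
  · intro z hz hz0
    obtain ⟨f, hf0, hf⟩ := hT.eigenvalue z hz hz0
    have hmem : f ∈ Module.End.eigenspace
        (T.toContinuousLinearMap : DalesDavieAlgebra X M →ₗ[ℂ] DalesDavieAlgebra X M) z :=
      Module.End.mem_eigenspace_iff.2 hf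
    have hle := (Module.End.genEigenspace
      (T.toContinuousLinearMap : DalesDavieAlgebra X M →ₗ[ℂ] DalesDavieAlgebra X M) z).monotone
      (le_top : (1 : ℕ∞) ≤ ⊤)
    exact ⟨hφ.finrank_maxGenEigenspace hperf hreg hT hx₀ hz0 hf0 hmem hle,
      hφ.finrank_maxGenEigenspace hperf hreg hT hx₀ hz0 hf0 (hle hmem) le_rfl⟩
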